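/- Let $G=(V,E)$ be a finite simple undirected graph with $|V|\ge 1$, maximum degree $\Delta$ and neighborhoods $\partial v$; let $\mathsf X=\{1,\dots,q\}^V$. For each $v\in V$ let $\mu_{v,0}$ be a probability measure on $\{1,\dots,q\}$ with $\mu_{v,0}(a)>0$ for all $a$, and put $\mu_0(x)=\prod_{v\in V}\mu_{v,0}(x_v)$, $\theta_d=\min_{v}\min_a\mu_{v,0}(a)$, $\theta=\min_{x\in\mathsf X}\mu_0(x)$. Let $\Phi$ and $\Psi$ be classes of functions on $\{1,\dots,q\}$ and on $\{1,\dots,q\}^2$, all with values in $[-1,1]$, and let $\mathcal F$ be the class of all costs $f(x)=\sum_{v\in V}\phi_v(x_v)+\sum_{\{u,v\}\in E}\psi_{u,v}(x_u,x_v)$ with $\phi_v\in\Phi$, $\psi_{u,v}\in\Psi$ (where $\psi_{u,v}(a,b)$ and $\psi_{v,u}(b,a)$ denote the same number). Given $\beta>0$ and costs $f_1,\dots,f_T\in\mathcal F$ with local terms $\phi_{v,t},\psi_{u,v,t}$, let $f_{v,t}(a,x_{\partial v})=\phi_{v,t}(a)+\sum_{u\in\partial v}\psi_{u,v,t}(x_u,a)$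 and $F_{v,t}=\frac1{t+1}\sum_{s=1}^t f_{v,s}$. In the Glauber-dynamics strategy, $X_0\sim\mu_0$, and at time $t+1$ a uniformly random agent $v$ redraws its action from $$\mathbb P_{v,t+1}(a\mid x_{\partial v,t})=\frac{\mu_{v,0}(a)\,e^{-\beta F_{v,t}(a,x_{\partial v,t})}}{\sum_{b}\mu_{v,0}(b)\,e^{-\beta F_{v,t}(b,x_{\partial v,t})}},$$ while all the other agents repeat their last action. Let $\mu_t$ be the law of $X_t$, let $\ell_t(\nu)=\beta\sum_x\nu(x)f_t(x)+D(\nu\|\mu_0)$, where $D$ is the relative entropy, and let $$R_T(\mathcal F)=\sup_{f_1,\dots,f_T\in\mathcal F}\Big(\sum_{t=1}^T\ell_t(\mu_t)-\inf_{\nu\in\mathcal P(\mathsf X)}\sum_{t=1}^T\ell_t(\nu)\Big).$$ **Theorem.** Suppose $\beta>0$ and $\Delta\beta<1$, and put $K=\max\{|V|,\beta|V|^2(\Delta+1)\}$. There is a constant $T_1=T_1(\beta,\Delta,|V|)>0$, depending only on $\beta$, $\Delta$ and $|V|$, such that for all $T\ge1$ $$R_T(\mathcal F)\le\frac{|V|}{1-\Delta\beta}\Big(2\beta^2|V|^3(\Delta+1)^2+K\Big(|V|\ln\frac{q^2}{\theta_d}+\ln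 T\Big)\Big)\ln(T+1)+2\big(\beta|V|(\Delta+1)\big)^2\ln(T+1)+T_1|V|\ln\frac{q^2}{\theta_d}+\frac{2\beta|V|^3(\Delta+1)}{1-\Delta\beta}+\ln\frac1\theta .$$ -/

import Mathlib

open scoped BigOperators

noncomputable section

/-- Relative entropy `D(μ ‖ ν) = ∑ x, μ x * log (μ x / ν x)` of two probability vectors on a finite
set, with `0 * log 0 = 0`. It is only used with an everywhere positive `ν`, where it is finite. -/
def relEntropy {X : Type*} [Fintype X] (μ ν : X → ℝ) : ℝ :=
  ∑ x, μ x * Real.log (μ x / ν x)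

/-- The local costs generated in one round: a vertex cost `phi v` for every agent `v` and an edge
cost `psi u v` for every edge. As the edges are undirected, `psi u v (x u) (x v)` and
`psi v u (x v) (x u)` are the same number. Values of `psi` at non-adjacent pairs are never used. -/
structure LocalCosts (V : Type*) (q : ℕ) where
  phi : V → Fin q → ℝ
  psi : V → V → Fin q → Fin q → ℝ
  psi_symm : ∀ u v a b, psi u v a b = psi v u b a

namespace LocalCosts

/-- The vertex costs belong to `Φ` and the edge costs to `Ψ`; an undirected edge may be written with
its endpoints in either order. -/
def MemClass {V : Type*} {q : ℕ} (c : LocalCosts V q) (G : SimpleGraph V)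
    (Φ : Set (Fin q → ℝ)) (Ψ : Set (Fin q → Fin q → ℝ)) : Prop :=
  (∀ v, c.phi v ∈ Φ) ∧ ∀ u v, G.Adj u v → c.psi u v ∈ Ψ ∨ c.psi v u ∈ Ψ

/-- The network cost `f x = ∑ v, φ_v (x_v) + ∑ {u, v} ∈ E, ψ_{u,v} (x_u, x_v)`; every undirected
edge is counted once. -/
def total {V : Type*} [Fintype V] {q : ℕ} (c : LocalCosts V q) (G : SimpleGraph V)
    [DecidableEq V] [DecidableRel G.Adj] (x : V → Fin q) : ℝ :=
  ∑ v, c.phi v (x v) +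
    ∑ e ∈ G.edgeFinset,
      Sym2.lift ⟨fun u v => c.psi u v (x u) (x v), fun u v => c.psi_symm u v (x u) (x v)⟩ e

/-- The local cost `f_v (a, y) = φ_v a + ∑ u ∈ ∂v, ψ_{u,v} (y_u, a)` of agent `v` playing `a` under
the boundary condition `y` on its neighborhood. -/
def atVertex {V : Type*} [Fintype V] {q : ℕ} (c : LocalCosts V q) (G : SimpleGraph V)
    [DecidableRel G.Adj] (v : V) (a : Fin q) (y : G.neighborSet v → Fin q) : ℝ :=
  c.phi v a + ∑ u : G.neighborSet v, c.psi u v (y u) a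

end LocalCosts

/-- The discounted cumulative local cost `F_{v,t} = (1 / (t + 1)) ∑_{s = 1}^t f_{v,s}`. -/
def discountedLocalCost {V : Type*} [Fintype V] {q : ℕ} (G : SimpleGraph V) [DecidableRel G.Adj]
    (c : ℕ → LocalCosts V q) (t : ℕ) (v : V) (a : Fin q) (y : G.neighborSet v → Fin q) : ℝ :=
  (1 / ((t : ℝ) + 1)) * ∑ s ∈ Finset.Icc 1 t, (c s).atVertex G v a y

/-- The local Gibbs update `ℙ_{v,t+1} (a | y)`: the probability that agent `v`, activated at time
`t + 1`, plays `a` when its neighbors last played `y`. -/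
def gibbsUpdate {V : Type*} [Fintype V] {q : ℕ} (G : SimpleGraph V) [DecidableRel G.Adj]
    (β : ℝ) (μ₀ : V → Fin q → ℝ) (c : ℕ → LocalCosts V q) (t : ℕ) (v : V) (a : Fin q)
    (y : G.neighborSet v → Fin q) : ℝ :=
  μ₀ v a * Real.exp (-β * discountedLocalCost G c t v a y) /
    ∑ b, μ₀ v b * Real.exp (-β * discountedLocalCost G c t v b y)

/-- The Glauber transition probability `ℙ_{t+1} (y | x)`: a uniformly random agent updates its action
by the local Gibbs rule and all the other agents replay theirs. -/
def glauberKernel {V : Type*} [Fintype V] [DecidableEq V] {q : ℕ} (G : SimpleGraph V)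
    [DecidableRel G.Adj] (β : ℝ) (μ₀ : V → Fin q → ℝ) (c : ℕ → LocalCosts V q) (t : ℕ)
    (x y : V → Fin q) : ℝ :=
  (1 / (Fintype.card V : ℝ)) *
    ∑ v, gibbsUpdate G β μ₀ c t v (y v) (fun u => x u) *
      (if ∀ u, u ≠ v → y u = x u then 1 else 0)

/-- The product measure `μ_0 (x) = ∏ v, μ_{v,0} (x_v)`. -/
def productLaw {V : Type*} [Fintype V] {q : ℕ} (μ₀ : V → Fin q → ℝ) (x : V → Fin q) : ℝ :=
  ∏ v, μ₀ v (x v)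

/-- The law `μ_t` of the network action profile `X_t`, where `X_0, X_1, …` is the Markov chain with
initial law `μ_0` and transition probabilities `ℙ_1, ℙ_2, …`. -/
def glauberLaw {V : Type*} [Fintype V] [DecidableEq V] {q : ℕ} (G : SimpleGraph V)
    [DecidableRel G.Adj] (β : ℝ) (μ₀ : V → Fin q → ℝ) (c : ℕ → LocalCosts V q) :
    ℕ → (V → Fin q) → ℝ
  | 0 => productLaw μ₀
  | t + 1 => fun y => ∑ x, glauberLaw G β μ₀ c t x * glauberKernel G β μ₀ c t x y

/-- The instantaneous loss `ℓ (ν) = β ⟨ν, f⟩ + D(ν ‖ μ_0)` of the network in a round with local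
costs `c`. -/
def networkLoss {V : Type*} [Fintype V] [DecidableEq V] {q : ℕ} (G : SimpleGraph V)
    [DecidableRel G.Adj] (β : ℝ) (μ₀ : V → Fin q → ℝ) (c : LocalCosts V q)
    (ν : (V → Fin q) → ℝ) : ℝ :=
  β * ∑ x, ν x * c.total G x + relEntropy ν (productLaw μ₀)

/-- The regret after `T` rounds of a sequence `μ 1, …, μ T` of laws of the action profile, with
respect to the costs `c 1, …, c T`. The infimum is over all probability vectors on the set of
action profiles. -/
def networkRegret {V : Type*} [Fintype V] [DecidableEq V] {q : ℕ} (G : SimpleGraph V)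
    [DecidableRel G.Adj] (β : ℝ) (μ₀ : V → Fin q → ℝ) (c : ℕ → LocalCosts V q)
    (μ : ℕ → (V → Fin q) → ℝ) (T : ℕ) : ℝ :=
  ∑ t ∈ Finset.Icc 1 T, networkLoss G β μ₀ (c t) (μ t) -
    ⨅ ν : stdSimplex ℝ (V → Fin q), ∑ t ∈ Finset.Icc 1 T, networkLoss G β μ₀ (c t) ν.1

/-- The worst-case regret of the Glauber-dynamics strategy: the supremum (in the extended reals) of
its regret over all cost sequences `c 1, …, c T` from the class given by `Φ` and `Ψ`. -/
def glauberWorstCaseRegret {V : Type*} [Fintype V] [DecidableEq V] {q : ℕ} (G : SimpleGraph V)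
    [DecidableRel G.Adj] (β : ℝ) (μ₀ : V → Fin q → ℝ) (Φ : Set (Fin q → ℝ))
    (Ψ : Set (Fin q → Fin q → ℝ)) (T : ℕ) : EReal :=
  ⨆ (c : ℕ → LocalCosts V q) (_ : ∀ t ∈ Finset.Icc 1 T, (c t).MemClass G Φ Ψ),
    (networkRegret G β μ₀ c (glauberLaw G β μ₀ c) T : EReal)

/-- The smallest probability `min_v min_a μ_{v,0} (a)`. -/
def minLocalProb {V : Type*} {q : ℕ} (μ₀ : V → Fin q → ℝ) : ℝ :=
  ⨅ v, ⨅ a, μ₀ v a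

/-- The smallest probability `min_x μ_0 (x)` of an action profile. -/
def minProfileProb {V : Type*} [Fintype V] {q : ℕ} (μ₀ : V → Fin q → ℝ) : ℝ :=
  ⨅ x : V → Fin q, productLaw μ₀ x

/-- The explicit regret bound, for `n` agents, maximum degree `Δ` and
`K = max {n, β n ^ 2 (Δ + 1)}`. -/
def regretBound (β : ℝ) (n Δ q : ℕ) (θd θ T₁ : ℝ) (T : ℕ) : ℝ :=
  let K : ℝ := max (n : ℝ) (β * (n : ℝ) ^ 2 * ((Δ : ℝ) + 1))
  (n : ℝ) / (1 - Δ * β) *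
      (2 * β ^ 2 * (n : ℝ) ^ 3 * ((Δ : ℝ) + 1) ^ 2 +
        K * (n * Real.log ((q : ℝ) ^ 2 / θd) + Real.log T)) * Real.log ((T : ℝ) + 1) +
    2 * (β * n * ((Δ : ℝ) + 1)) ^ 2 * Real.log ((T : ℝ) + 1) +
    T₁ * n * Real.log ((q : ℝ) ^ 2 / θd) +
    2 * β * (n : ℝ) ^ 3 * ((Δ : ℝ) + 1) / (1 - Δ * β) +
    Real.log (1 / θ)

end

/-! Let π_t (`globalGibbs`) be the Gibbs measure with reference μ_0 and energy β/(t+1) · ∑_{s ≤ t}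
f_s. It minimizes ∑_{s ≤ t} ℓ_s + D(· ‖ μ_0), so playing π_t in round t+1 is follow-the-leader with
one extra copy of the entropy. The Gibbs variational identity bounds its regret by D(ν ‖ μ_0) + ∑
(t+2) D(π_t ‖ π_{t+1}) (`followTheLeader_le`). The energy changes by O(1/t) per round, so each
divergence is O(1/t²) and the sum is O(ln T).

The network cannot play π_t, but the Glauber step at time t+1 is reversible for it
(`globalGibbs_mul_glauberKernel`). A neighbor influences a local update by at most β in total
variation, so for Δβ < 1 each step contracts the Hamming-Wasserstein distance by 1 - κ with κ = (1 -
Δβ)/|V| (`CoordLipschitz.glauberKernel`). Contraction against a drift of order 1/t keeps the law of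
X_{t+1} within C/(t+1) + O(1/(t+1)²) of π_t (`exists_trackingBound_le`).

A continuity estimate for the entropy (`relEntropy_sub_le`) turns this distance into a loss gap of
order (ln t)/t, hence the (ln T)² in the bound. The remaining terms are constant or linear in ln T,
with coefficients depending only on β, Δ and |V|; `absorb_lower_order` hides them in the constant T₁
and in half of the quadratic term. -/

/-- The total variation distance of two vectors of equal total mass. -/
def tvDist {X : Type*} [Fintype X] (p q : X → ℝ) : ℝ := ∑ x, max (p x - q x) 0

/-- The Gibbs vector with reference weights `w` and energy `h`. -/
noncomputable def gibbsVec {X : Type*} [Fintype X] (w h : X → ℝ) (x : X) : ℝ :=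
  w x * Real.exp (-h x) / ∑ y, w y * Real.exp (-h y)

/-! ### Total variation on finite sets. -/

section FiniteProbability

variable {X : Type*} [Fintype X]

theorem tvDist_comm {p q : X → ℝ} (hpq : ∑ x, p x = ∑ x, q x) : tvDist p q = tvDist q p := by
  have h : tvDist p q - tvDist q p = ∑ x, (p x - q x) := by
    unfold tvDist
    rw [← Finset.sum_sub_distrib]
    refine Finset.sum_congr rfl fun x _ => ?_
    rcases le_total (p x) (q x) with h | h
    · rw [max_eq_right (by linarith), max_eq_left (by linarith)]; ring
    · rw [max_eq_left (by linarith), max_eq_right (by linarith)]; ring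
  rw [Finset.sum_sub_distrib, hpq, sub_self] at h
  linarith

/-- As the masses agree, the minimum of `f` can be subtracted, after which `f` lies in `[0, L]` and
only the positive part of `p - q` matters. -/
theorem sum_sub_mul_le_tvDist {p q f : X → ℝ} {L : ℝ} (hpq : ∑ x, p x = ∑ x, q x)
    (hf : ∀ x y, f x - f y ≤ L) : ∑ x, (p x - q x) * f x ≤ L * tvDist p q := by
  rcases isEmpty_or_nonempty X with hX | hX
  · simp [tvDist]
  obtain ⟨x₀, hx₀⟩ := Finite.exists_min f
  have h : ∑ x, (p x - q x) * f x = ∑ x, (p x - q x) * (f x - f x₀) := by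
    simp only [mul_sub, Finset.sum_sub_distrib, ← Finset.sum_mul, hpq, sub_self, zero_mul, sub_zero]
  rw [h, tvDist, Finset.mul_sum]
  refine Finset.sum_le_sum fun x _ => ?_
  have h1 := hf x x₀
  have h2 := hx₀ x
  have h3 := le_max_left (p x - q x) 0
  have h4 := le_max_right (p x - q x) 0
  calc (p x - q x) * (f x - f x₀) ≤ max (p x - q x) 0 * (f x - f x₀) :=
        mul_le_mul_of_nonneg_right h3 (by linarith)
    _ ≤ max (p x - q x) 0 * L := mul_le_mul_of_nonneg_left h1 h4
    _ = _ := mul_comm _ _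

theorem tvDist_eq_sum_indicator (p q : X → ℝ) :
    tvDist p q = ∑ x, (p x - q x) * (if q x < p x then 1 else 0) := by
  refine Finset.sum_congr rfl fun x _ => ?_
  split_ifs with h
  · rw [max_eq_left (by linarith), mul_one]
  · rw [max_eq_right (by linarith), mul_zero]

/-! ### Gibbs vectors: total variation, variational identity, divergence. -/

section Gibbs

variable {w h h' : X → ℝ}

theorem gibbsVec_partition_pos [Nonempty X] (hw : ∀ x, 0 < w x) (h : X → ℝ) :
    0 < ∑ y, w y * Real.exp (-h y) :=
  Finset.sum_pos (fun x _ => mul_pos (hw x) (Real.exp_pos _)) Finset.univ_nonempty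

theorem gibbsVec_pos [Nonempty X] (hw : ∀ x, 0 < w x) (h : X → ℝ) (x : X) : 0 < gibbsVec w h x :=
  div_pos (mul_pos (hw x) (Real.exp_pos _)) (gibbsVec_partition_pos hw h)

theorem sum_gibbsVec [Nonempty X] (hw : ∀ x, 0 < w x) (h : X → ℝ) : ∑ x, gibbsVec w h x = 1 := by
  unfold gibbsVec
  rw [← Finset.sum_div, div_self (gibbsVec_partition_pos hw h).ne']

/-- If the odds differ by a factor of at most `s ^ 2`, the gap is largest at `a' = 1 / (s + 1)`,
where it equals `(s - 1) / (s + 1)`. -/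
theorem sub_mul_le_of_odds_le {a a' s : ℝ} (ha' : 0 ≤ a') (hs : 1 ≤ s)
    (h : a * (1 - a') ≤ s ^ 2 * (a' * (1 - a))) : (a - a') * (s + 1) ≤ s - 1 := by
  have hD : 0 < 1 - a' + s ^ 2 * a' := by
    have h0 : a' ≤ s ^ 2 * a' := le_mul_of_one_le_left ha' (one_le_pow₀ hs)
    linarith
  have h1 : (a - a') * (1 - a' + s ^ 2 * a') ≤ (s ^ 2 - 1) * (a' * (1 - a')) := by nlinarith
  have h2 : (s + 1) ^ 2 * (a' * (1 - a')) ≤ 1 - a' + s ^ 2 * a' := by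
    nlinarith [sq_nonneg (a' * s - (1 - a'))]
  have h3 : (a - a') * (s + 1) * (1 - a' + s ^ 2 * a') ≤ (s - 1) * (1 - a' + s ^ 2 * a') := by
    calc (a - a') * (s + 1) * (1 - a' + s ^ 2 * a')
        = ((a - a') * (1 - a' + s ^ 2 * a')) * (s + 1) := by ring
      _ ≤ ((s ^ 2 - 1) * (a' * (1 - a'))) * (s + 1) :=
        mul_le_mul_of_nonneg_right h1 (by linarith)
      _ = (s - 1) * ((s + 1) ^ 2 * (a' * (1 - a'))) := by ring
      _ ≤ _ := mul_le_mul_of_nonneg_left h2 (by linarith)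
  exact le_of_mul_le_mul_right h3 hD

/-- This is `tanh x ≤ x` with denominators cleared. -/
theorem exp_sub_one_le_mul_exp_add_one {x : ℝ} (hx : 0 ≤ x) :
    Real.exp (2 * x) - 1 ≤ x * (Real.exp (2 * x) + 1) := by
  have h : MonotoneOn (fun y : ℝ => y * (Real.exp (2 * y) + 1) - (Real.exp (2 * y) - 1))
      (Set.Ici 0) := by
    have hd : ∀ y : ℝ, HasDerivAt
        (fun y : ℝ => y * (Real.exp (2 * y) + 1) - (Real.exp (2 * y) - 1))
        (1 * (Real.exp (2 * y) + 1) + y * (Real.exp (2 * y) * (2 * 1)) -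
          Real.exp (2 * y) * (2 * 1)) y := by
      intro y
      have he : HasDerivAt (fun y : ℝ => Real.exp (2 * y)) (Real.exp (2 * y) * (2 * 1)) y :=
        ((hasDerivAt_id y).const_mul 2).exp
      exact ((hasDerivAt_id y).mul (he.add_const 1)).sub (he.sub_const 1)
    refine monotoneOn_of_deriv_nonneg (convex_Ici 0)
      (fun y _ => (hd y).continuousAt.continuousWithinAt)
      (fun y _ => (hd y).differentiableAt.differentiableWithinAt) fun y hy => ?_
    rw [(hd y).deriv]
    have h1 := Real.add_one_le_exp (-(2 * y))
    have h2 : Real.exp (-(2 * y)) * Real.exp (2 * y) = 1 := by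
      rw [← Real.exp_add]; simp
    nlinarith [Real.exp_pos (2 * y)]
  have := h (Set.mem_Ici.2 le_rfl) (Set.mem_Ici.2 hx) hx
  simp at this
  linarith

/-- The distance is attained on the event where the first vector is larger. Its odds under the two
vectors differ by a factor of at most `exp ω`, so the gap is at most `tanh (ω / 4)`. The sharp
constant 1/4 is what makes `Δ * β < 1` the contraction condition. -/
theorem tvDist_gibbsVec_le [Nonempty X] (hw : ∀ x, 0 < w x) {ω : ℝ}
    (hω : ∀ x y, (h x - h' x) - (h y - h' y) ≤ ω) :
    tvDist (gibbsVec w h) (gibbsVec w h') ≤ ω / 4 := by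
  have hω0 : 0 ≤ ω := by
    obtain ⟨x⟩ := ‹Nonempty X›
    simpa using hω x x
  set p := gibbsVec w h with hp
  set p' := gibbsVec w h' with hp'
  set i : X → ℝ := fun x => if p' x < p x then 1 else 0 with hi
  have hi0 : ∀ x, 0 ≤ i x := fun x => by simp only [hi]; split_ifs <;> norm_num
  have hi1 : ∀ x, i x ≤ 1 := fun x => by simp only [hi]; split_ifs <;> norm_num
  have hpp : ∀ x, 0 < p x := gibbsVec_pos hw h
  have hpp' : ∀ x, 0 < p' x := gibbsVec_pos hw h'
  have hs : ∑ x, p x = 1 := sum_gibbsVec hw h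
  have hs' : ∑ x, p' x = 1 := sum_gibbsVec hw h'
  set a := ∑ x, p x * i x with ha
  set a' := ∑ x, p' x * i x with ha'
  have hc : 1 - a = ∑ x, p x * (1 - i x) := by
    simp only [mul_sub, mul_one, Finset.sum_sub_distrib, hs, ha]
  have hc' : 1 - a' = ∑ x, p' x * (1 - i x) := by
    simp only [mul_sub, mul_one, Finset.sum_sub_distrib, hs', ha']
  have htv : tvDist p p' = a - a' := by
    rw [tvDist_eq_sum_indicator]
    simp only [ha, ha', hi, sub_mul, Finset.sum_sub_distrib]
  have ha0 : 0 ≤ a' := Finset.sum_nonneg fun x _ => mul_nonneg (hpp' x).le (hi0 x)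
  have hodds : ∀ x y, p x * p' y ≤ Real.exp ω * (p' x * p y) := by
    intro x y
    have hz := gibbsVec_partition_pos hw h
    have hz' := gibbsVec_partition_pos hw h'
    have he : Real.exp (-h x) * Real.exp (-h' y) ≤
        Real.exp ω * (Real.exp (-h' x) * Real.exp (-h y)) := by
      rw [← Real.exp_add, ← Real.exp_add, ← Real.exp_add]
      exact Real.exp_le_exp.2 (by linarith [hω y x])
    simp only [hp, hp', gibbsVec]
    set z := ∑ y, w y * Real.exp (-h y)
    set z' := ∑ y, w y * Real.exp (-h' y)
    have e1 : w x * Real.exp (-h x) / z * (w y * Real.exp (-h' y) / z') =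
        (w x * w y / (z * z')) * (Real.exp (-h x) * Real.exp (-h' y)) := by
      field_simp
    have e2 : Real.exp ω * (w x * Real.exp (-h' x) / z' * (w y * Real.exp (-h y) / z)) =
        (w x * w y / (z * z')) * (Real.exp ω * (Real.exp (-h' x) * Real.exp (-h y))) := by
      field_simp
    rw [e1, e2]
    exact mul_le_mul_of_nonneg_left he
      (div_nonneg (mul_nonneg (hw x).le (hw y).le) (mul_pos hz hz').le)
  -- The pointwise odds bound is summed over `x` in the event and `y` outside it. The square root of
  -- `exp ω` is written as `exp (2 * (ω / 4))` to fit the tanh inequality.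
  have key : a * (1 - a') ≤ Real.exp (2 * (ω / 4)) ^ 2 * (a' * (1 - a)) := by
    rw [← Real.exp_nat_mul, show ((2 : ℕ) : ℝ) * (2 * (ω / 4)) = ω by push_cast; ring, hc, hc', ha,
      ha', Finset.sum_mul_sum, Finset.sum_mul_sum, Finset.mul_sum]
    refine Finset.sum_le_sum fun x _ => ?_
    rw [Finset.mul_sum]
    refine Finset.sum_le_sum fun y _ => ?_
    calc p x * i x * (p' y * (1 - i y)) = (p x * p' y) * (i x * (1 - i y)) := by ring
      _ ≤ (Real.exp ω * (p' x * p y)) * (i x * (1 - i y)) :=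
        mul_le_mul_of_nonneg_right (hodds x y) (mul_nonneg (hi0 x) (by linarith [hi1 y]))
      _ = _ := by ring
  have hs1 : 1 ≤ Real.exp (2 * (ω / 4)) := Real.one_le_exp (by positivity)
  have h1 := sub_mul_le_of_odds_le ha0 hs1 key
  have h2 := exp_sub_one_le_mul_exp_add_one (x := ω / 4) (by positivity)
  rw [htv]
  exact le_of_mul_le_mul_right (h1.trans h2) (by linarith)

theorem relEntropy_nonneg {p r : X → ℝ} (hp : ∀ x, 0 ≤ p x) (hr : ∀ x, 0 < r x)
    (hpr : ∑ x, p x = ∑ x, r x) : 0 ≤ relEntropy p r := by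
  have h : ∑ x, (p x - r x) ≤ relEntropy p r := by
    refine Finset.sum_le_sum fun x _ => ?_
    rcases (hp x).eq_or_lt with h0 | h0
    · rw [← h0]; simpa using (hr x).le
    · have h1 := Real.log_le_sub_one_of_pos (div_pos (hr x) h0)
      have h2 : Real.log (p x / r x) = -Real.log (r x / p x) := by
        rw [← Real.log_inv, inv_div]
      have h3 : p x * (r x / p x) = r x := by field_simp
      rw [h2]
      nlinarith
  rw [Finset.sum_sub_distrib, hpr, sub_self] at h
  exact h

theorem log_gibbsVec [Nonempty X] (hw : ∀ x, 0 < w x) (h : X → ℝ) (x : X) :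
    Real.log (gibbsVec w h x) =
      Real.log (w x) - h x - Real.log (∑ y, w y * Real.exp (-h y)) := by
  unfold gibbsVec
  rw [Real.log_div (mul_pos (hw x) (Real.exp_pos _)).ne' (gibbsVec_partition_pos hw h).ne',
    Real.log_mul (hw x).ne' (Real.exp_pos _).ne', Real.log_exp]
  ring

theorem mul_log_div {a b : ℝ} (hb : 0 < b) :
    a * Real.log (a / b) = a * Real.log a - a * Real.log b := by
  by_cases ha : a = 0
  · simp [ha]
  · rw [Real.log_div ha hb.ne']; ring

/-- The Gibbs variational identity. -/
theorem sum_mul_add_relEntropy [Nonempty X] (hw : ∀ x, 0 < w x) (h : X → ℝ) {p : X → ℝ}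
    (hp : ∑ x, p x = 1) :
    ∑ x, p x * h x + relEntropy p w =
      -Real.log (∑ y, w y * Real.exp (-h y)) + relEntropy p (gibbsVec w h) := by
  have e : -Real.log (∑ y, w y * Real.exp (-h y)) =
      ∑ x, p x * -Real.log (∑ y, w y * Real.exp (-h y)) := by
    rw [← Finset.sum_mul, hp, one_mul]
  rw [e]
  unfold relEntropy
  rw [← Finset.sum_add_distrib, ← Finset.sum_add_distrib]
  refine Finset.sum_congr rfl fun x _ => ?_
  rw [mul_log_div (hw x), mul_log_div (gibbsVec_pos hw h x), log_gibbsVec hw]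
  ring

/-- The partition functions cancel in the symmetrized divergence, which equals the integral of `h' -
h` against the difference of the two vectors, at most `ω` times their distance. The reverse
divergence is nonnegative and is dropped. -/
theorem relEntropy_gibbsVec_le [Nonempty X] (hw : ∀ x, 0 < w x) {ω : ℝ}
    (hω : ∀ x y, (h x - h' x) - (h y - h' y) ≤ ω) :
    relEntropy (gibbsVec w h) (gibbsVec w h') ≤ ω ^ 2 / 4 := by
  have hω0 : 0 ≤ ω := by
    obtain ⟨x⟩ := ‹Nonempty X›
    simpa using hω x x
  have hs := sum_gibbsVec hw h
  have hs' := sum_gibbsVec hw h'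
  have h0 : 0 ≤ relEntropy (gibbsVec w h') (gibbsVec w h) :=
    relEntropy_nonneg (fun x => (gibbsVec_pos hw h' x).le) (gibbsVec_pos hw h) (by rw [hs, hs'])
  have h1 := sum_mul_add_relEntropy hw h hs
  have h2 := sum_mul_add_relEntropy hw h hs'
  have h3 := sum_mul_add_relEntropy hw h' hs
  have h4 := sum_mul_add_relEntropy hw h' hs'
  have z : ∀ p : X → ℝ, relEntropy p p = 0 := fun p => by
    unfold relEntropy
    refine Finset.sum_eq_zero fun x _ => ?_
    by_cases hx : p x = 0
    · simp [hx]
    · simp [div_self hx]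
  rw [z] at h1 h4
  have h5 : ∑ x, (gibbsVec w h x - gibbsVec w h' x) * (h' x - h x) ≤
      ω * tvDist (gibbsVec w h) (gibbsVec w h') :=
    sum_sub_mul_le_tvDist (by rw [hs, hs']) fun x y => by linarith [hω y x]
  have h6 := mul_le_mul_of_nonneg_left (tvDist_gibbsVec_le hw hω) hω0
  simp only [sub_mul, mul_sub, Finset.sum_sub_distrib] at h5
  nlinarith

end Gibbs

/-! ### Bounds for the entropy relative to a positive reference. -/

theorem relEntropy_le_log_inv {p w : X → ℝ} {θ : ℝ} (hp : ∀ x, 0 ≤ p x) (hp1 : ∑ x, p x = 1)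
    (hθ : 0 < θ) (hw : ∀ x, θ ≤ w x) : relEntropy p w ≤ Real.log (1 / θ) := by
  have e : Real.log (1 / θ) = ∑ x, p x * Real.log (1 / θ) := by
    rw [← Finset.sum_mul, hp1, one_mul]
  rw [e]
  refine Finset.sum_le_sum fun x _ => ?_
  rcases (hp x).eq_or_lt with h0 | h0
  · simp [← h0]
  · have hx1 : p x ≤ 1 := hp1 ▸ Finset.single_le_sum (fun y _ => hp y) (Finset.mem_univ x)
    refine mul_le_mul_of_nonneg_left (Real.log_le_log (div_pos h0 (hθ.trans_le (hw x))) ?_) h0.le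
    exact div_le_div₀ zero_le_one hx1 hθ (hw x)

/-- A continuity estimate for the relative entropy with respect to a positive reference vector. -/
theorem relEntropy_sub_le {p r w : X → ℝ} {θ τ : ℝ} (hp : ∀ x, 0 ≤ p x) (hr : ∀ x, 0 ≤ r x)
    (hp1 : ∑ x, p x = 1) (hr1 : ∑ x, r x = 1) (hθ : 0 < θ) (hw : ∀ x, θ ≤ w x)
    (hw1 : ∀ x, w x ≤ 1) (hτ : 0 < τ) :
    relEntropy p w - relEntropy r w ≤
      tvDist p r * (Real.log (1 / θ) + Real.log (Fintype.card X) + Real.log τ) + 1 / τ := by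
  have hX : Nonempty X := by
    by_contra hX
    rw [not_nonempty_iff] at hX
    simp at hp1
  have hN : (0 : ℝ) < Fintype.card X := by exact_mod_cast Fintype.card_pos
  set N : ℝ := (Fintype.card X : ℝ)
  -- Where `p` is larger, `u * log u` has slope at most 1 on `[0, 1]`. Where `r` is larger by `a`,
  -- superadditivity of `u * log u` leaves `-a * log a`, which is bounded by its tangent at `1 / (N
  -- * τ)`. The constants `+1` and `-1` cancel in the sum, since both parts have mass `tvDist p r`.
  have hpt : ∀ x, p x * Real.log (p x / w x) - r x * Real.log (r x / w x) ≤
      max (p x - r x) 0 * (Real.log (1 / θ) + 1) +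
        (max (r x - p x) 0 * (Real.log (N * τ) - 1) + 1 / (N * τ)) := by
    intro x
    have hwx : 0 < w x := hθ.trans_le (hw x)
    have hε : 0 < 1 / (N * τ) := by positivity
    have hx1 : p x ≤ 1 := hp1 ▸ Finset.single_le_sum (fun y _ => hp y) (Finset.mem_univ x)
    rw [mul_log_div hwx, mul_log_div hwx]
    have hlw : -Real.log (w x) ≤ Real.log (1 / θ) := by
      rw [one_div, Real.log_inv]
      exact neg_le_neg (Real.log_le_log hθ (hw x))
    rcases le_total (r x) (p x) with hx | hx
    · rw [max_eq_left (by linarith), max_eq_right (by linarith), zero_mul, zero_add]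
      have key : p x * Real.log (p x) - r x * Real.log (r x) ≤ p x - r x := by
        rcases (hr x).eq_or_lt with h0 | h0
        · rw [← h0]
          have := mul_nonpos_of_nonneg_of_nonpos (hp x) (Real.log_nonpos (hp x) hx1)
          simp only [zero_mul, sub_zero]
          linarith [hp x]
        · have hpx : 0 < p x := h0.trans_le hx
          have h1 := Real.log_le_sub_one_of_pos (div_pos hpx h0)
          rw [Real.log_div hpx.ne' h0.ne'] at h1
          have h2 : r x * (p x / r x) = p x := by field_simp
          have h3 := Real.log_nonpos (hp x) hx1
          nlinarith
      nlinarith [mul_le_mul_of_nonneg_left hlw (sub_nonneg.2 hx)]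
    · rw [max_eq_right (by linarith), max_eq_left (by linarith), zero_mul, zero_add]
      rcases hx.eq_or_lt with h0 | h0
      · rw [h0]; simp only [sub_self, zero_mul, zero_add]; exact hε.le
      set a := r x - p x with ha
      have ha0 : 0 < a := by linarith
      have hra : r x = p x + a := by ring
      have hrx : 0 < r x := (hp x).trans_lt h0
      have h1 : p x * Real.log (p x) ≤ p x * Real.log (r x) := by
        rcases (hp x).eq_or_lt with h0 | h0
        · simp [← h0]
        · exact mul_le_mul_of_nonneg_left (Real.log_le_log h0 hx) h0.le
      have h2 : a * Real.log a ≤ a * Real.log (r x) :=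
        mul_le_mul_of_nonneg_left (Real.log_le_log ha0 (by linarith [hp x])) ha0.le
      have h3 : a * Real.log (w x) ≤ 0 :=
        mul_nonpos_of_nonneg_of_nonpos ha0.le (Real.log_nonpos hwx.le (hw1 x))
      have h4 := Real.log_le_sub_one_of_pos (div_pos hε ha0)
      rw [Real.log_div hε.ne' ha0.ne', one_div, Real.log_inv] at h4
      have h5 : a * ((N * τ)⁻¹ / a) = (N * τ)⁻¹ := by field_simp
      rw [one_div]
      have h6 : a * (-Real.log (N * τ) - Real.log a) ≤ (N * τ)⁻¹ - a := by
        have := mul_le_mul_of_nonneg_left h4 ha0.le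
        rw [mul_sub a (_ / a), h5] at this
        linarith
      have h7 : r x * Real.log (r x) = p x * Real.log (r x) + a * Real.log (r x) := by
        nth_rewrite 1 [hra]; ring
      have h8 : r x * Real.log (w x) = p x * Real.log (w x) + a * Real.log (w x) := by
        nth_rewrite 1 [hra]; ring
      nlinarith
  have hsum := Finset.sum_le_sum fun x (_ : x ∈ Finset.univ) => hpt x
  rw [Finset.sum_sub_distrib, Finset.sum_add_distrib, Finset.sum_add_distrib, ← Finset.sum_mul,
    ← Finset.sum_mul, Finset.sum_const, Finset.card_univ, nsmul_eq_mul] at hsum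
  have e1 : N * (1 / (N * τ)) = 1 / τ := by field_simp
  have e2 : (∑ x, max (r x - p x) 0) = tvDist p r := tvDist_comm (by rw [hp1, hr1])
  have e3 : (∑ x, max (p x - r x) 0) = tvDist p r := rfl
  rw [e1, e2, e3, Real.log_mul hN.ne' hτ.ne'] at hsum
  unfold relEntropy
  linarith

end FiniteProbability

/-! ### Follow the leader. -/

/-- The regret of the minimizers of the regularized cumulative losses (follow the leader). -/
theorem followTheLeader_le {X : Type*} [Fintype X] [Nonempty X] {w : X → ℝ} (hw : ∀ x, 0 < w x)
    (hw1 : ∑ x, w x = 1) (f : ℕ → X → ℝ) {h : ℕ → X → ℝ}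
    (hh : ∀ t x, h t x = (1 / ((t : ℝ) + 1)) * ∑ s ∈ Finset.Icc 1 t, f s x)
    (T : ℕ) {p : X → ℝ} (hp : ∀ x, 0 ≤ p x) (hp1 : ∑ x, p x = 1) :
    ∑ t ∈ Finset.range T,
        (∑ x, gibbsVec w (h t) x * f (t + 1) x + relEntropy (gibbsVec w (h t)) w) ≤
      ∑ t ∈ Finset.range T, (∑ x, p x * f (t + 1) x + relEntropy p w) + relEntropy p w +
        ∑ t ∈ Finset.range T,
          ((t : ℝ) + 2) * relEntropy (gibbsVec w (h t)) (gibbsVec w (h (t + 1))) := by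
  have hrec : ∀ (t : ℕ) (x : X), ((t : ℝ) + 2) * h (t + 1) x = ((t : ℝ) + 1) * h t x + f (t + 1) x := by
    intro t x
    rw [hh, hh, Finset.sum_Icc_succ_top (by omega)]
    push_cast
    field_simp
    ring
  have hrecp : ∀ (t : ℕ) (r : X → ℝ), ((t : ℝ) + 2) * ∑ x, r x * h (t + 1) x =
      ((t : ℝ) + 1) * ∑ x, r x * h t x + ∑ x, r x * f (t + 1) x := by
    intro t r
    rw [Finset.mul_sum, Finset.mul_sum, ← Finset.sum_add_distrib]
    refine Finset.sum_congr rfl fun x _ => ?_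
    linear_combination r x * hrec t x
  have h0 : ∀ x, h 0 x = 0 := fun x => by rw [hh]; simp
  set z : ℕ → ℝ := fun t => Real.log (∑ y, w y * Real.exp (-h t y)) with hz
  have hvar : ∀ (t : ℕ) {r : X → ℝ}, ∑ x, r x = 1 → ∑ x, r x * h t x + relEntropy r w =
      -z t + relEntropy r (gibbsVec w (h t)) := fun t r hr => sum_mul_add_relEntropy hw (h t) hr
  have hself : ∀ r : X → ℝ, (∀ x, 0 < r x) → relEntropy r r = 0 := fun r hr =>
    Finset.sum_eq_zero fun x _ => by rw [div_self (hr x).ne', Real.log_one, mul_zero]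
  -- An exact identity: the variational identity for the same Gibbs vector at the energies `h T` and
  -- `h (T + 1)` makes the scaled free energies `-(T + 1) * z T` telescope.
  have hlead : ∀ T : ℕ, ∑ t ∈ Finset.range T,
        (∑ x, gibbsVec w (h t) x * f (t + 1) x + relEntropy (gibbsVec w (h t)) w) =
      -((T : ℝ) + 1) * z T + ∑ t ∈ Finset.range T,
          ((t : ℝ) + 2) * relEntropy (gibbsVec w (h t)) (gibbsVec w (h (t + 1))) := by
    intro T
    induction T with
    | zero => simp [hz, h0, hw1]
    | succ T ih =>
      rw [Finset.sum_range_succ, Finset.sum_range_succ, ih]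
      have hs := sum_gibbsVec hw (h T)
      have e1 := hvar T hs
      have e2 := hvar (T + 1) hs
      have e3 := hrecp T (gibbsVec w (h T))
      rw [hself _ (gibbsVec_pos hw (h T))] at e1
      push_cast
      linear_combination (-(T : ℝ) - 1) * e1 + ((T : ℝ) + 2) * e2 - e3
  have hcomp : ∀ T : ℕ, ∑ t ∈ Finset.range T, (∑ x, p x * f (t + 1) x + relEntropy p w) +
      relEntropy p w = ((T : ℝ) + 1) * (∑ x, p x * h T x + relEntropy p w) := by
    intro T
    induction T with
    | zero => simp [h0]
    | succ T ih =>
      rw [Finset.sum_range_succ]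
      have := hrecp T p
      push_cast
      linear_combination ih - this
  rw [hlead, hcomp, hvar T hp1]
  have h1 : 0 ≤ relEntropy p (gibbsVec w (h T)) :=
    relEntropy_nonneg hp (gibbsVec_pos hw (h T)) (by rw [hp1, sum_gibbsVec hw])
  nlinarith [mul_nonneg (by positivity : (0 : ℝ) ≤ (T : ℝ) + 1) h1]

/-! ### Hamming-Lipschitz functions. -/

/-- Changing one coordinate changes `f` by at most `L`: the function is `L`-Lipschitz for the
Hamming distance. -/
def CoordLipschitz {V A : Type*} [DecidableEq V] (f : (V → A) → ℝ) (L : ℝ) : Prop :=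
  ∀ x v a, f (Function.update x v a) - f x ≤ L

theorem CoordLipschitz.sub_le {V A : Type*} [Fintype V] [DecidableEq V] {f : (V → A) → ℝ} {L : ℝ}
    (hf : CoordLipschitz f L) (x y : V → A) : f x - f y ≤ Fintype.card V * L := by
  have h : ∀ s : Finset V, f (s.piecewise x y) - f y ≤ s.card * L := by
    intro s
    induction s using Finset.induction_on with
    | empty => simp
    | insert j s hj ih =>
      rw [Finset.piecewise_insert, Finset.card_insert_of_notMem hj]
      have := hf (s.piecewise x y) j (x j)
      push_cast
      linarith
  simpa using h Finset.univ

/-! ### Size and locality of the network cost. -/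

namespace LocalCosts

/-- The local costs on vertices and edges of `G` take values in `[-1, 1]`. -/
def IsBounded {V : Type*} {q : ℕ} (c : LocalCosts V q) (G : SimpleGraph V) : Prop :=
  (∀ v a, |c.phi v a| ≤ 1) ∧ ∀ u v, G.Adj u v → ∀ a b, |c.psi u v a b| ≤ 1

theorem MemClass.isBounded {V : Type*} {q : ℕ} {c : LocalCosts V q} {G : SimpleGraph V}
    {Φ : Set (Fin q → ℝ)} {Ψ : Set (Fin q → Fin q → ℝ)} (hc : c.MemClass G Φ Ψ)
    (hΦ : ∀ φ ∈ Φ, ∀ a, φ a ∈ Set.Icc (-1 : ℝ) 1)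
    (hΨ : ∀ ψ ∈ Ψ, ∀ a b, ψ a b ∈ Set.Icc (-1 : ℝ) 1) : c.IsBounded G := by
  refine ⟨fun v a => abs_le.2 (hΦ _ (hc.1 v) a), fun u v huv a b => ?_⟩
  rcases hc.2 u v huv with h | h
  · exact abs_le.2 (hΨ _ h a b)
  · rw [c.psi_symm]
    exact abs_le.2 (hΨ _ h b a)

variable {V : Type*} [Fintype V] [DecidableEq V] {q : ℕ} {G : SimpleGraph V} [DecidableRel G.Adj]
  {c : LocalCosts V q}

theorem abs_total_le (hc : c.IsBounded G) (x : V → Fin q) :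
    |c.total G x| ≤ Fintype.card V * ((G.maxDegree : ℝ) + 1) := by
  have h1 : |∑ v, c.phi v (x v)| ≤ Fintype.card V := by
    refine (Finset.abs_sum_le_sum_abs _ _).trans ((Finset.sum_le_sum fun v _ => hc.1 v _).trans ?_)
    simp
  have h2 : |∑ e ∈ G.edgeFinset,
      Sym2.lift ⟨fun u v => c.psi u v (x u) (x v), fun u v => c.psi_symm u v (x u) (x v)⟩ e| ≤
      G.edgeFinset.card := by
    refine (Finset.abs_sum_le_sum_abs _ _).trans ?_
    rw [Finset.card_eq_sum_ones, Nat.cast_sum]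
    refine Finset.sum_le_sum fun e he => ?_
    induction e using Sym2.ind with
    | _ u v =>
      rw [Sym2.lift_mk]
      simpa using hc.2 u v (by simpa using he) (x u) (x v)
  have h3 : (G.edgeFinset.card : ℝ) ≤ Fintype.card V * (G.maxDegree : ℝ) := by
    have h := G.sum_degrees_eq_twice_card_edges
    have h' : ∑ v, G.degree v ≤ Fintype.card V * G.maxDegree := by
      refine (Finset.sum_le_sum fun v _ => G.degree_le_maxDegree v).trans ?_
      simp
    exact_mod_cast (by omega : G.edgeFinset.card ≤ Fintype.card V * G.maxDegree)
  unfold total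
  refine (abs_add_le _ _).trans ?_
  linarith

theorem sum_edgeFinset_mem (g : Sym2 V → ℝ) (v : V) :
    ∑ e ∈ G.edgeFinset with v ∈ e, g e = ∑ u : G.neighborSet v, g s((u : V), v) := by
  symm
  refine Finset.sum_bij (fun (u : G.neighborSet v) _ => s((u : V), v)) ?_ ?_ ?_ ?_
  · intro u _
    have := u.2
    rw [SimpleGraph.mem_neighborSet] at this
    simp [this.symm]
  · intro u _ u' _ h
    rcases Sym2.eq_iff.1 h with h | h
    · exact Subtype.ext h.1
    · exact Subtype.ext (h.1.trans h.2)
  · intro e he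
    rw [Finset.mem_filter, SimpleGraph.mem_edgeFinset] at he
    obtain ⟨he, u, rfl⟩ := he
    exact ⟨⟨u, he⟩, Finset.mem_univ _, Sym2.eq_swap⟩
  · intro u _
    rfl

/-- The local cost of `v` collects exactly the terms of the network cost that see `x v`. Hence the
local Gibbs rule is the conditional law of the global Gibbs measure, which gives detailed balance.
-/
theorem total_sub_atVertex_eq {x y : V → Fin q} {v : V} (hxy : ∀ u, u ≠ v → y u = x u) :
    c.total G y - c.atVertex G v (y v) (fun u => y u) =
      c.total G x - c.atVertex G v (x v) (fun u => x u) := by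
  have h : ∀ x : V → Fin q, c.total G x - c.atVertex G v (x v) (fun u => x u) =
      ∑ u ∈ Finset.univ.erase v, c.phi u (x u) + ∑ e ∈ G.edgeFinset with v ∉ e,
        Sym2.lift ⟨fun u v => c.psi u v (x u) (x v), fun u v => c.psi_symm u v (x u) (x v)⟩ e := by
    intro x
    unfold total atVertex
    rw [← Finset.sum_filter_add_sum_filter_not G.edgeFinset (fun e => v ∈ e),
      sum_edgeFinset_mem, ← Finset.add_sum_erase _ _ (Finset.mem_univ v)]
    simp only [Sym2.lift_mk]
    ring
  rw [h, h]
  congr 1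
  · exact Finset.sum_congr rfl fun u hu => by rw [hxy u (Finset.ne_of_mem_erase hu)]
  · refine Finset.sum_congr rfl fun e he => ?_
    replace he := (Finset.mem_filter.1 he).2
    induction e using Sym2.ind with
    | _ a b =>
      rw [Sym2.mem_iff, not_or] at he
      simp only [Sym2.lift_mk, hxy a (Ne.symm he.1), hxy b (Ne.symm he.2)]

theorem abs_atVertex_sub_le (hc : c.IsBounded G) {v w : V} (hvw : G.Adj v w) (a b : Fin q)
    (x : V → Fin q) :
    |c.atVertex G v a (fun u => Function.update x w b u) - c.atVertex G v a (fun u => x u)| ≤ 2 := by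
  have h : c.atVertex G v a (fun u => Function.update x w b u) - c.atVertex G v a (fun u => x u) =
      c.psi w v b a - c.psi w v (x w) a := by
    unfold atVertex
    rw [add_sub_add_left_eq_sub, ← Finset.sum_sub_distrib]
    rw [Fintype.sum_eq_single (⟨w, hvw⟩ : G.neighborSet v)]
    · simp
    · intro u hu
      have : (u : V) ≠ w := fun h => hu (Subtype.ext h)
      simp [Function.update_of_ne this]
  rw [h]
  have h1 := abs_le.1 (hc.2 w v hvw.symm b a)
  have h2 := abs_le.1 (hc.2 w v hvw.symm (x w) a)
  exact abs_le.2 ⟨by linarith, by linarith⟩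

end LocalCosts

/-! ### The local Gibbs update. -/

section LocalUpdate

variable {V : Type*} [Fintype V] {q : ℕ} {G : SimpleGraph V} [DecidableRel G.Adj]
  {β : ℝ} {μ₀ : V → Fin q → ℝ} {c : ℕ → LocalCosts V q} {t : ℕ}

theorem gibbsUpdate_eq_gibbsVec (v : V) (y : G.neighborSet v → Fin q) :
    (fun a => gibbsUpdate G β μ₀ c t v a y) =
      gibbsVec (μ₀ v) (fun a => β * discountedLocalCost G c t v a y) := by
  funext a
  simp only [gibbsUpdate, gibbsVec, neg_mul]

theorem gibbsUpdate_pos (hμ : ∀ v a, 0 < μ₀ v a) (v : V) (a : Fin q)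
    (y : G.neighborSet v → Fin q) : 0 < gibbsUpdate G β μ₀ c t v a y := by
  have : Nonempty (Fin q) := ⟨a⟩
  have := gibbsVec_pos (hμ v) (fun a => β * discountedLocalCost G c t v a y) a
  rwa [← gibbsUpdate_eq_gibbsVec] at this

theorem sum_gibbsUpdate [Nonempty (Fin q)] (hμ : ∀ v a, 0 < μ₀ v a) (v : V)
    (y : G.neighborSet v → Fin q) : ∑ a, gibbsUpdate G β μ₀ c t v a y = 1 := by
  have := sum_gibbsVec (hμ v) (fun a => β * discountedLocalCost G c t v a y)
  rwa [← gibbsUpdate_eq_gibbsVec] at this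

theorem productLaw_pos (hμ : ∀ v a, 0 < μ₀ v a) (x : V → Fin q) : 0 < productLaw μ₀ x :=
  Finset.prod_pos fun v _ => hμ v _

theorem productLaw_le_one (hμ : ∀ v, μ₀ v ∈ stdSimplex ℝ (Fin q)) (x : V → Fin q) :
    productLaw μ₀ x ≤ 1 :=
  Finset.prod_le_one (fun v _ => (hμ v).1 _) fun v _ =>
    (hμ v).2 ▸ Finset.single_le_sum (fun b _ => (hμ v).1 b) (Finset.mem_univ (x v))

end LocalUpdate

/-! ### The Glauber kernel: reversibility and Dobrushin contraction. -/

section Glauber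

variable {V : Type*} [Fintype V] [DecidableEq V] {q : ℕ} {G : SimpleGraph V} [DecidableRel G.Adj]
  {β : ℝ} {μ₀ : V → Fin q → ℝ} {c : ℕ → LocalCosts V q} {t : ℕ}

theorem sum_glauberKernel_mul (x : V → Fin q) (f : (V → Fin q) → ℝ) :
    ∑ y, glauberKernel G β μ₀ c t x y * f y = (1 / (Fintype.card V : ℝ)) *
      ∑ v, ∑ a, gibbsUpdate G β μ₀ c t v a (fun u => x u) * f (Function.update x v a) := by
  simp only [glauberKernel, mul_assoc, ← Finset.mul_sum, Finset.sum_mul]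
  rw [Finset.sum_comm]
  congr 1
  refine Finset.sum_congr rfl fun v _ => ?_
  simp only [ite_mul, one_mul, zero_mul, mul_ite, mul_zero]
  rw [← Finset.sum_filter]
  symm
  refine Finset.sum_bij (fun a _ => Function.update x v a) ?_ ?_ ?_ ?_
  · intro a _
    simp only [Finset.mem_filter, Finset.mem_univ, true_and]
    exact fun u hu => Function.update_of_ne hu _ _
  · intro a _ b _ h
    exact Function.update_injective x v h
  · intro y hy
    refine ⟨y v, Finset.mem_univ _, ?_⟩
    funext u
    by_cases hu : u = v
    · subst hu; simp
    · rw [Function.update_of_ne hu, (Finset.mem_filter.1 hy).2 u hu]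
  · intro a _
    simp

theorem glauberKernel_nonneg (hμ : ∀ v a, 0 < μ₀ v a) (x y : V → Fin q) :
    0 ≤ glauberKernel G β μ₀ c t x y := by
  refine mul_nonneg (by positivity) (Finset.sum_nonneg fun v _ => mul_nonneg ?_ ?_)
  · exact (gibbsUpdate_pos hμ v _ _).le
  · split_ifs <;> norm_num

theorem sum_glauberKernel [Nonempty V] [Nonempty (Fin q)] (hμ : ∀ v a, 0 < μ₀ v a)
    (x : V → Fin q) : ∑ y, glauberKernel G β μ₀ c t x y = 1 := by
  have h := sum_glauberKernel_mul (G := G) (β := β) (μ₀ := μ₀) (c := c) (t := t) x (fun _ => 1)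
  simp only [mul_one, sum_gibbsUpdate hμ] at h
  rw [h]
  have : (Fintype.card V : ℝ) ≠ 0 := by exact_mod_cast Fintype.card_ne_zero
  simp [this]

theorem sum_productLaw (hμ : ∀ v, μ₀ v ∈ stdSimplex ℝ (Fin q)) : ∑ x, productLaw μ₀ x = 1 := by
  have h := Fintype.prod_sum μ₀
  simp only [fun v => (hμ v).2, Finset.prod_const_one] at h
  exact h.symm

theorem sum_glauberLaw [Nonempty V] [Nonempty (Fin q)] (hμ : ∀ v a, 0 < μ₀ v a)
    (hμ1 : ∀ v, μ₀ v ∈ stdSimplex ℝ (Fin q)) (t : ℕ) : ∑ x, glauberLaw G β μ₀ c t x = 1 := by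
  induction t with
  | zero => exact sum_productLaw hμ1
  | succ t ih =>
    simp only [glauberLaw]
    rw [Finset.sum_comm]
    simp only [← Finset.mul_sum, sum_glauberKernel hμ, mul_one, ih]

theorem glauberLaw_nonneg (hμ : ∀ v a, 0 < μ₀ v a) (t : ℕ) (x : V → Fin q) :
    0 ≤ glauberLaw G β μ₀ c t x := by
  induction t generalizing x with
  | zero => exact (productLaw_pos hμ x).le
  | succ t ih => exact Finset.sum_nonneg fun y _ => mul_nonneg (ih y) (glauberKernel_nonneg hμ y x)

theorem sum_glauberLaw_succ_mul (f : (V → Fin q) → ℝ) :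
    ∑ y, glauberLaw G β μ₀ c (t + 1) y * f y =
      ∑ x, glauberLaw G β μ₀ c t x * ∑ y, glauberKernel G β μ₀ c t x y * f y := by
  simp only [glauberLaw, Finset.sum_mul, Finset.mul_sum]
  rw [Finset.sum_comm]
  exact Finset.sum_congr rfl fun x _ => Finset.sum_congr rfl fun y _ => mul_assoc _ _ _

/-- The discounted cumulative network cost. -/
noncomputable def discountedTotal (G : SimpleGraph V) [DecidableRel G.Adj]
    (c : ℕ → LocalCosts V q) (t : ℕ) (x : V → Fin q) : ℝ :=
  (1 / ((t : ℝ) + 1)) * ∑ s ∈ Finset.Icc 1 t, (c s).total G x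

/-- The global Gibbs measure towards which the Glauber step at time `t + 1` relaxes. -/
noncomputable def globalGibbs (G : SimpleGraph V) [DecidableRel G.Adj] (β : ℝ)
    (μ₀ : V → Fin q → ℝ) (c : ℕ → LocalCosts V q) (t : ℕ) : (V → Fin q) → ℝ :=
  gibbsVec (productLaw μ₀) (fun x => β * discountedTotal G c t x)

theorem discountedTotal_sub_eq {x y : V → Fin q} {v : V} (hxy : ∀ u, u ≠ v → y u = x u) :
    discountedTotal G c t y - discountedLocalCost G c t v (y v) (fun u => y u) =
      discountedTotal G c t x - discountedLocalCost G c t v (x v) (fun u => x u) := by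
  simp only [discountedTotal, discountedLocalCost, ← mul_sub, ← Finset.sum_sub_distrib,
    LocalCosts.total_sub_atVertex_eq hxy]

theorem productLaw_mul_eq {x y : V → Fin q} {v : V} (hxy : ∀ u, u ≠ v → y u = x u) :
    productLaw μ₀ x * μ₀ v (y v) = productLaw μ₀ y * μ₀ v (x v) := by
  unfold productLaw
  have h : ∏ u ∈ Finset.univ.erase v, μ₀ u (y u) = ∏ u ∈ Finset.univ.erase v, μ₀ u (x u) :=
    Finset.prod_congr rfl fun u hu => by rw [hxy u (Finset.ne_of_mem_erase hu)]
  rw [← Finset.mul_prod_erase Finset.univ (fun u => μ₀ u (x u)) (Finset.mem_univ v),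
    ← Finset.mul_prod_erase Finset.univ (fun u => μ₀ u (y u)) (Finset.mem_univ v), h]
  ring

/-- Detailed balance. -/
theorem globalGibbs_mul_glauberKernel (x y : V → Fin q) :
    globalGibbs G β μ₀ c t x * glauberKernel G β μ₀ c t x y =
      globalGibbs G β μ₀ c t y * glauberKernel G β μ₀ c t y x := by
  unfold glauberKernel
  simp only [Finset.mul_sum]
  refine Finset.sum_congr rfl fun v _ => ?_
  rw [mul_left_comm, mul_left_comm (globalGibbs G β μ₀ c t y)]
  congr 1
  by_cases hxy : ∀ u, u ≠ v → y u = x u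
  · rw [if_pos hxy, if_pos fun u hu => (hxy u hu).symm, mul_one, mul_one]
    -- A vertex is not its own neighbor, so both transitions use the same boundary condition and the
    -- same normalization.
    have hnb : (fun u : G.neighborSet v => y u) = fun u : G.neighborSet v => x u :=
      funext fun u => hxy u (G.ne_of_adj u.2).symm
    have h1 := discountedTotal_sub_eq (G := G) (c := c) (t := t) hxy
    have h2 := productLaw_mul_eq (μ₀ := μ₀) hxy
    rw [hnb] at h1 ⊢
    unfold globalGibbs gibbsVec gibbsUpdate
    rw [div_mul_div_comm, div_mul_div_comm]
    congr 1
    have h3 : Real.exp (-(β * discountedTotal G c t x)) *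
          Real.exp (-β * discountedLocalCost G c t v (y v) fun u => x u) =
        Real.exp (-(β * discountedTotal G c t y)) *
          Real.exp (-β * discountedLocalCost G c t v (x v) fun u => x u) := by
      rw [← Real.exp_add, ← Real.exp_add]
      congr 1
      linear_combination β * h1
    calc _ = (productLaw μ₀ x * μ₀ v (y v)) * (Real.exp (-(β * discountedTotal G c t x)) *
          Real.exp (-β * discountedLocalCost G c t v (y v) fun u => x u)) := by ring
      _ = _ := by rw [h2, h3]; ring
  · rw [if_neg hxy, if_neg fun h => hxy fun u hu => (h u hu).symm]
    simp

theorem sum_globalGibbs_mul_kernel [Nonempty V] [Nonempty (Fin q)] (hμ : ∀ v a, 0 < μ₀ v a)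
    (f : (V → Fin q) → ℝ) :
    ∑ x, globalGibbs G β μ₀ c t x * ∑ y, glauberKernel G β μ₀ c t x y * f y =
      ∑ y, globalGibbs G β μ₀ c t y * f y := by
  simp only [Finset.mul_sum]
  rw [Finset.sum_comm]
  refine Finset.sum_congr rfl fun y _ => ?_
  simp only [← mul_assoc, globalGibbs_mul_glauberKernel _ y]
  rw [← Finset.sum_mul, ← Finset.mul_sum, sum_glauberKernel hμ, mul_one]

/-- The influence of a neighbor on the local Gibbs update is at most `β`. -/
theorem tvDist_gibbsUpdate_le [Nonempty (Fin q)] (hβ : 0 ≤ β) (hμ : ∀ v a, 0 < μ₀ v a)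
    (hc : ∀ s ∈ Finset.Icc 1 t, (c s).IsBounded G) {v w : V} (hvw : G.Adj v w) (b : Fin q)
    (x : V → Fin q) :
    tvDist (fun a => gibbsUpdate G β μ₀ c t v a (fun u => Function.update x w b u))
      (fun a => gibbsUpdate G β μ₀ c t v a (fun u => x u)) ≤ β := by
  have hd : ∀ a, |β * discountedLocalCost G c t v a (fun u => Function.update x w b u) -
      β * discountedLocalCost G c t v a (fun u => x u)| ≤ 2 * β := by
    intro a
    rw [← mul_sub, abs_mul, abs_of_nonneg hβ, mul_comm]
    refine mul_le_mul_of_nonneg_right ?_ hβ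
    unfold discountedLocalCost
    rw [← mul_sub, ← Finset.sum_sub_distrib, abs_mul, abs_of_nonneg (by positivity)]
    have h : |∑ s ∈ Finset.Icc 1 t, ((c s).atVertex G v a (fun u => Function.update x w b u) -
        (c s).atVertex G v a (fun u => x u))| ≤ t * 2 := by
      refine (Finset.abs_sum_le_sum_abs _ _).trans ((Finset.sum_le_sum fun s hs =>
        LocalCosts.abs_atVertex_sub_le (hc s hs) hvw a b x).trans ?_)
      simp
    rw [one_div, inv_mul_le_iff₀ (by positivity)]
    linarith
  rw [gibbsUpdate_eq_gibbsVec, gibbsUpdate_eq_gibbsVec]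
  -- Each local energy moves by at most `2 * β`, so the oscillation of the difference is at most `4
  -- * β`.
  refine (tvDist_gibbsVec_le (hμ v) (ω := 4 * β) fun a a' => ?_).trans (by linarith)
  have h1 := abs_le.1 (hd a)
  have h2 := abs_le.1 (hd a')
  linarith

/-- Dobrushin contraction of the Glauber kernel. -/
theorem CoordLipschitz.glauberKernel [Nonempty V] [Nonempty (Fin q)] (hβ : 0 ≤ β)
    (hμ : ∀ v a, 0 < μ₀ v a) (hc : ∀ s ∈ Finset.Icc 1 t, (c s).IsBounded G)
    {f : (V → Fin q) → ℝ} {L : ℝ} (hL : 0 ≤ L) (hf : CoordLipschitz f L) :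
    CoordLipschitz (fun x => ∑ y, glauberKernel G β μ₀ c t x y * f y)
      ((1 - (1 - G.maxDegree * β) / Fintype.card V) * L) := by
  intro x w b
  simp only [sum_glauberKernel_mul]
  rw [← mul_sub, ← Finset.sum_sub_distrib]
  have hn : (0 : ℝ) < Fintype.card V := by exact_mod_cast Fintype.card_pos
  -- Resampling `w` itself erases the discrepancy (contribution 0); a non-neighbor keeps it (`L`); a
  -- neighbor keeps it and adds the change of its own update law (`L + β * L`). In total this is `(n
  -- - 1 + Δ * β) * L`.
  have hterm : ∀ v, ∑ a, gibbsUpdate G β μ₀ c t v a (fun u => Function.update x w b u) *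
        f (Function.update (Function.update x w b) v a) -
      ∑ a, gibbsUpdate G β μ₀ c t v a (fun u => x u) * f (Function.update x v a) ≤
      L - (if v = w then L else 0) + (if G.Adj w v then β * L else 0) := by
    intro v
    have hsum' := sum_gibbsUpdate (G := G) (β := β) (c := c) (t := t) hμ v
      (fun u => Function.update x w b u)
    have hsum := sum_gibbsUpdate (G := G) (β := β) (c := c) (t := t) hμ v (fun u => x u)
    by_cases hadj : G.Adj w v
    · have hne : v ≠ w := hadj.ne'
      rw [if_neg hne, if_pos hadj]
      have h1 := sum_sub_mul_le_tvDist (f := fun a => f (Function.update x v a)) (L := L)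
        (hsum'.trans hsum.symm) fun a a' => by
          have := hf (Function.update x v a') v a
          rwa [Function.update_idem] at this
      have h2 := mul_le_mul_of_nonneg_left (tvDist_gibbsUpdate_le hβ hμ hc hadj.symm b x) hL
      have h3 : ∑ a, gibbsUpdate G β μ₀ c t v a (fun u => Function.update x w b u) *
          (f (Function.update (Function.update x w b) v a) - f (Function.update x v a)) ≤ L := by
        calc _ ≤ ∑ a, gibbsUpdate G β μ₀ c t v a (fun u => Function.update x w b u) * L := by
              refine Finset.sum_le_sum fun a _ =>
                mul_le_mul_of_nonneg_left ?_ (gibbsUpdate_pos hμ v a _).le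
              rw [Function.update_comm hne.symm]
              exact hf _ _ _
          _ = L := by rw [← Finset.sum_mul, hsum', one_mul]
      simp only [mul_sub, sub_mul, Finset.sum_sub_distrib] at h1 h3
      linarith
    · rw [if_neg hadj, add_zero]
      have hnb : (fun u : G.neighborSet v => Function.update x w b u) =
          fun u : G.neighborSet v => x u := by
        funext u
        refine Function.update_of_ne (fun h => hadj ?_) _ _
        rw [← h]
        exact u.2.symm
      rw [hnb]
      by_cases hvw : v = w
      · subst hvw
        simp
      · rw [if_neg hvw, sub_zero, ← Finset.sum_sub_distrib]
        calc _ ≤ ∑ a, gibbsUpdate G β μ₀ c t v a (fun u => x u) * L := by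
              refine Finset.sum_le_sum fun a _ => ?_
              rw [← mul_sub]
              refine mul_le_mul_of_nonneg_left ?_ (gibbsUpdate_pos hμ v a _).le
              rw [Function.update_comm (Ne.symm hvw)]
              exact hf _ _ _
          _ = L := by rw [← Finset.sum_mul, hsum, one_mul]
  have hdeg : ∑ v, (if G.Adj w v then β * L else 0) ≤ G.maxDegree * (β * L) := by
    rw [← Finset.sum_filter, Finset.sum_const, nsmul_eq_mul, ← G.neighborFinset_eq_filter,
      G.card_neighborFinset_eq_degree]
    exact mul_le_mul_of_nonneg_right (by exact_mod_cast G.degree_le_maxDegree w) (by positivity)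
  have htot := Finset.sum_le_sum fun v (_ : v ∈ Finset.univ) => hterm v
  rw [Finset.sum_add_distrib, Finset.sum_sub_distrib, Finset.sum_sub_distrib, Finset.sum_ite_eq' Finset.univ w,
    if_pos (Finset.mem_univ w), Finset.sum_const, Finset.card_univ, nsmul_eq_mul] at htot
  rw [one_div, inv_mul_le_iff₀ hn]
  have e : (Fintype.card V : ℝ) * ((1 - (1 - G.maxDegree * β) / Fintype.card V) * L) =
      Fintype.card V * L - L + G.maxDegree * (β * L) := by
    field_simp
    ring
  rw [e, Finset.sum_sub_distrib]
  linarith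

theorem sum_globalGibbs [Nonempty (Fin q)] (hμ : ∀ v a, 0 < μ₀ v a) (t : ℕ) :
    ∑ x, globalGibbs G β μ₀ c t x = 1 :=
  sum_gibbsVec (productLaw_pos hμ) _

theorem globalGibbs_zero [Nonempty (Fin q)] (hμ1 : ∀ v, μ₀ v ∈ stdSimplex ℝ (Fin q)) :
    globalGibbs G β μ₀ c 0 = productLaw μ₀ := by
  funext x
  simp [globalGibbs, gibbsVec, discountedTotal, sum_productLaw hμ1]

theorem networkLoss_eq (d : LocalCosts V q) (ν : (V → Fin q) → ℝ) :
    networkLoss G β μ₀ d ν = ∑ x, ν x * (β * d.total G x) + relEntropy ν (productLaw μ₀) := by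
  unfold networkLoss
  rw [Finset.mul_sum]
  congr 1
  exact Finset.sum_congr rfl fun x _ => mul_left_comm _ _ _

end Glauber

/-! ### Harmonic-type sums. -/

section HarmonicSums

theorem sum_range_inv_le (T : ℕ) :
    ∑ t ∈ Finset.range T, 1 / ((t : ℝ) + 1) ≤ 1 + Real.log T := by
  have h := harmonic_le_one_add_log T
  simp only [harmonic, Rat.cast_sum, Rat.cast_inv, Rat.cast_natCast] at h
  push_cast at h
  simpa [one_div] using h

theorem sum_range_inv_sq_le (T : ℕ) :
    ∑ t ∈ Finset.range T, 1 / ((t : ℝ) + 1) ^ 2 ≤ 2 := by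
  have h : ∑ t ∈ Finset.range T, 1 / ((t : ℝ) + 1) ^ 2 ≤ 2 - 1 / (T : ℝ) := by
    induction T with
    | zero => norm_num
    | succ T ih =>
      rw [Finset.sum_range_succ]
      rcases Nat.eq_zero_or_pos T with rfl | hT
      · norm_num
      have hT0 : (0 : ℝ) < T := by exact_mod_cast hT
      have e : 1 / (T : ℝ) - 1 / ((T : ℝ) + 1) = 1 / ((T : ℝ) * ((T : ℝ) + 1)) := by
        field_simp
        ring
      have h1 : 1 / ((T : ℝ) + 1) ^ 2 ≤ 1 / ((T : ℝ) * ((T : ℝ) + 1)) :=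
        one_div_le_one_div_of_le (by positivity) (by nlinarith)
      push_cast
      linarith
  have : 0 ≤ 1 / (T : ℝ) := by positivity
  linarith

theorem sum_range_log_div_le {T : ℕ} (hT : 1 ≤ T) :
    ∑ t ∈ Finset.range T, Real.log ((t : ℝ) + 1) / ((t : ℝ) + 1) ≤
      Real.log T ^ 2 / 2 + 1 / 2 := by
  -- The correction `-1 / (2 * T)` makes the induction close: its increments pay for replacing `log
  -- T` by `log (T + 1)` in the last summand.
  have h : ∑ t ∈ Finset.range T, Real.log ((t : ℝ) + 1) / ((t : ℝ) + 1) ≤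
      Real.log T ^ 2 / 2 + 1 / 2 - 1 / (2 * (T : ℝ)) := by
    induction T, hT using Nat.le_induction with
    | base => norm_num
    | succ T hT ih =>
      rw [Finset.sum_range_succ]
      have hT0 : (0 : ℝ) < T := by exact_mod_cast hT
      push_cast
      set l := Real.log T
      set l' := Real.log ((T : ℝ) + 1)
      have hd : l' - l = Real.log (((T : ℝ) + 1) / T) :=
        (Real.log_div (by positivity) hT0.ne').symm
      have h1 : 1 / ((T : ℝ) + 1) ≤ l' - l := by
        have := Real.log_le_sub_one_of_pos (show (0 : ℝ) < T / (T + 1) by positivity)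
        rw [Real.log_div hT0.ne' (by positivity)] at this
        have e : (T : ℝ) / (T + 1) - 1 = -(1 / (T + 1)) := by field_simp; ring
        linarith
      have h2 : l' - l ≤ 1 / T := by
        rw [hd]
        refine (Real.log_le_sub_one_of_pos (by positivity)).trans (le_of_eq ?_)
        field_simp
        ring
      have hl : 0 ≤ l := Real.log_nonneg (by exact_mod_cast hT)
      have hl' : 0 ≤ l' + l := by
        have : (0 : ℝ) ≤ 1 / ((T : ℝ) + 1) := by positivity
        linarith
      have h3 : 1 / ((T : ℝ) + 1) * (2 * l' - 1 / T) ≤ (l' - l) * (l' + l) := by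
        calc 1 / ((T : ℝ) + 1) * (2 * l' - 1 / T) ≤ 1 / ((T : ℝ) + 1) * (l' + l) :=
              mul_le_mul_of_nonneg_left (by linarith) (by positivity)
          _ ≤ _ := mul_le_mul_of_nonneg_right h1 hl'
      have e1 : 1 / ((T : ℝ) + 1) * (2 * l' - 1 / T) =
          2 * (l' / ((T : ℝ) + 1)) - (1 / T - 1 / ((T : ℝ) + 1)) := by
        field_simp
        ring
      have e2 : ∀ a : ℝ, 1 / (2 * a) = 1 / a / 2 := fun a => by rw [div_div, mul_comm]
      rw [e2] at ih ⊢
      nlinarith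
  have : 0 ≤ 1 / (2 * (T : ℝ)) := by positivity
  linarith

end HarmonicSums

/-! ### The tracking recursion and the lower order terms. -/

/-- The distance bound to a target drifting at rate `κ * C / (t + 2)`, contracted by `1 - κ` in each
step. -/
noncomputable def trackingBound (κ C : ℝ) : ℕ → ℝ
  | 0 => 0
  | t + 1 => (1 - κ) * (trackingBound κ C t + κ * C / ((t : ℝ) + 2))

/-- A drift `κ * C / t` balances a contraction loss `κ * u` at `u ≈ C / t`. The leading constant has
to be exactly `C`, because it becomes the coefficient of the main regret term. -/
theorem exists_trackingBound_le {κ C : ℝ} (hκ : 0 < κ) (hκ1 : κ ≤ 1) (hC : 0 ≤ C) :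
    ∃ M : ℝ, 0 ≤ M ∧ ∀ t : ℕ,
      trackingBound κ C t ≤ C * (1 / ((t : ℝ) + 1)) + M * (1 / ((t : ℝ) + 1) ^ 2) := by
  have hle : ∀ t, trackingBound κ C t ≤ C := by
    intro t
    induction t with
    | zero => exact hC
    | succ t ih =>
      have h1 : κ * C / ((t : ℝ) + 2) ≤ κ * C :=
        div_le_self (by positivity) (by linarith [(Nat.cast_nonneg t : (0 : ℝ) ≤ t)])
      calc (1 - κ) * (trackingBound κ C t + κ * C / ((t : ℝ) + 2))
          ≤ (1 - κ) * (C + κ * C) := mul_le_mul_of_nonneg_left (by linarith) (by linarith)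
        _ = C - κ ^ 2 * C := by ring
        _ ≤ C := by nlinarith [mul_nonneg (sq_nonneg κ) hC]
  -- From this time on the profiles `1 / (t + 1)` and `1 / (t + 1) ^ 2` are each preserved by the
  -- recursion. Before it, `M` is large enough for the second term alone to exceed the trivial bound
  -- `C`.
  obtain ⟨N, hN⟩ := exists_nat_ge (4 / κ ^ 2)
  have hM : 0 ≤ C * ((N : ℝ) + 1) ^ 2 := by positivity
  have hsmall : ∀ t : ℕ, t ≤ N → trackingBound κ C t ≤
      C * (1 / ((t : ℝ) + 1)) + C * ((N : ℝ) + 1) ^ 2 * (1 / ((t : ℝ) + 1) ^ 2) := by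
    intro t ht
    have ht' : (t : ℝ) ≤ N := by exact_mod_cast ht
    have h1 : C ≤ C * ((N : ℝ) + 1) ^ 2 * (1 / ((t : ℝ) + 1) ^ 2) := by
      rw [mul_assoc]
      refine le_mul_of_one_le_right hC ?_
      rw [mul_one_div, one_le_div (by positivity)]
      gcongr
    have h2 : 0 ≤ C * (1 / ((t : ℝ) + 1)) := by positivity
    linarith [hle t]
  refine ⟨C * ((N : ℝ) + 1) ^ 2, hM, fun t => ?_⟩
  rcases le_total t N with ht | ht
  · exact hsmall t ht
  induction t, ht using Nat.le_induction with
  | base => exact hsmall N le_rfl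
  | succ t ht ih =>
    set M := C * ((N : ℝ) + 1) ^ 2
    have ht' : (N : ℝ) ≤ t := by exact_mod_cast ht
    have hκt : 4 ≤ κ ^ 2 * (t + 1) := by
      have := (div_le_iff₀ (by positivity)).1 (hN.trans ht')
      nlinarith [sq_nonneg κ]
    set s : ℝ := (t : ℝ) + 1 with hs
    have hs0 : 0 < s := by positivity
    have e : (((t + 1 : ℕ) : ℝ) + 1) = s + 1 := by push_cast; ring
    have e' : (t : ℝ) + 2 = s + 1 := by rw [hs]; ring
    rw [e]
    unfold trackingBound
    rw [e']
    refine (mul_le_mul_of_nonneg_left (add_le_add_left ih _) (by linarith)).trans ?_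
    have h1 : (1 - κ) * (1 / s + κ / (s + 1)) ≤ 1 / (s + 1) := by
      rw [div_add_div _ _ hs0.ne' (by positivity), mul_div_assoc', div_le_div_iff₀ (by positivity)
        (by positivity)]
      nlinarith [mul_nonneg hκ.le hs0.le]
    have h2 : (1 - κ) * (1 / s ^ 2) ≤ 1 / (s + 1) ^ 2 := by
      have hκs : 4 ≤ κ * s := by nlinarith [mul_pos hκ hs0]
      rw [mul_one_div, div_le_div_iff₀ (by positivity) (by positivity)]
      nlinarith
    calc _ = C * ((1 - κ) * (1 / s + κ / (s + 1))) + M * ((1 - κ) * (1 / s ^ 2)) := by ring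
      _ ≤ _ := add_le_add (mul_le_mul_of_nonneg_left h1 hC) (mul_le_mul_of_nonneg_left h2 hM)

theorem sum_mul_add_log_le {u : ℕ → ℝ} {C M E : ℝ} (hC : 0 ≤ C) (hM : 0 ≤ M) (hE : 0 ≤ E)
    (hu : ∀ t : ℕ, u t ≤ C * (1 / ((t : ℝ) + 1)) + M * (1 / ((t : ℝ) + 1) ^ 2))
    {T : ℕ} (hT : 1 ≤ T) :
    ∑ t ∈ Finset.range T, u t * (E + Real.log ((t : ℝ) + 1)) ≤
      E * (C * (1 + Real.log T) + 2 * M) + C * (Real.log T ^ 2 / 2 + 1 / 2) +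
        2 * M * Real.log T := by
  have hlT : 0 ≤ Real.log T := Real.log_nonneg (by exact_mod_cast hT)
  have h : ∑ t ∈ Finset.range T, u t * (E + Real.log ((t : ℝ) + 1)) ≤
      ∑ t ∈ Finset.range T, (E * C * (1 / ((t : ℝ) + 1)) +
        (E * M + M * Real.log T) * (1 / ((t : ℝ) + 1) ^ 2) +
          C * (Real.log ((t : ℝ) + 1) / ((t : ℝ) + 1))) := by
    refine Finset.sum_le_sum fun t ht => ?_
    have ht' : (t : ℝ) + 1 ≤ T := by exact_mod_cast Finset.mem_range.1 ht
    have hl0 : 0 ≤ Real.log ((t : ℝ) + 1) :=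
      Real.log_nonneg (by linarith [(Nat.cast_nonneg t : (0 : ℝ) ≤ t)])
    have hl : Real.log ((t : ℝ) + 1) ≤ Real.log T := Real.log_le_log (by positivity) ht'
    have h1 := mul_le_mul_of_nonneg_right (hu t) (add_nonneg hE hl0)
    have h2 : M * (1 / ((t : ℝ) + 1) ^ 2) * Real.log ((t : ℝ) + 1) ≤
        M * (1 / ((t : ℝ) + 1) ^ 2) * Real.log T :=
      mul_le_mul_of_nonneg_left hl (by positivity)
    rw [div_eq_mul_one_div (Real.log _)]
    linarith
  refine h.trans ?_
  rw [Finset.sum_add_distrib, Finset.sum_add_distrib, ← Finset.mul_sum, ← Finset.mul_sum,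
    ← Finset.mul_sum]
  have h1 := mul_le_mul_of_nonneg_left (sum_range_inv_le T) (mul_nonneg hE hC)
  have h2 := mul_le_mul_of_nonneg_left (sum_range_inv_sq_le T)
    (add_nonneg (mul_nonneg hE hM) (mul_nonneg hM hlT))
  have h3 := mul_le_mul_of_nonneg_left (sum_range_log_div_le hT) hC
  linarith

/-- Here `l` stands for `log T`. The sum of logarithms uses only half of `C * l ^ 2`; the other half
absorbs the terms linear in `l` by completing the square. Constants are absorbed through `1 ≤ y`. -/
theorem absorb_lower_order {y y' l C C₀ M B : ℝ} (hC₀ : 0 ≤ C₀) (hCC : C₀ ≤ C) (hC : 0 < C)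
    (hM : 0 ≤ M) (hB : 0 ≤ B) (hl : 0 ≤ l) (hy' : 0 ≤ y') (hyy : y' ≤ y) (hy : 1 ≤ y) :
    (2 * B + y') * (C₀ * (1 + l) + 2 * M) + C₀ * (l ^ 2 / 2 + 1 / 2) + 2 * M * l + (1 + l) +
        4 * B ^ 2 * (1 + l) + y' ≤
      C * (y + l) * l + (C₀ + 2 * M + 1 + (2 * B * (C₀ + 2 * M) + C₀ / 2 + 1 + 4 * B ^ 2) +
        (2 * B * C₀ + 2 * M + 1 + 4 * B ^ 2) ^ 2 / (2 * C)) * y := by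
  have h1 : (2 * B * C₀ + 2 * M + 1 + 4 * B ^ 2) * l ≤
      C / 2 * l ^ 2 + (2 * B * C₀ + 2 * M + 1 + 4 * B ^ 2) ^ 2 / (2 * C) := by
    set A := 2 * B * C₀ + 2 * M + 1 + 4 * B ^ 2
    have e : C / 2 * l ^ 2 + A ^ 2 / (2 * C) - A * l = (C * l - A) ^ 2 / (2 * C) := by
      field_simp
      ring
    have : 0 ≤ (C * l - A) ^ 2 / (2 * C) := by positivity
    linarith
  set R := (2 * B * C₀ + 2 * M + 1 + 4 * B ^ 2) ^ 2 / (2 * C)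
  have hR : 0 ≤ R := by positivity
  have h2 : R * 1 ≤ R * y := mul_le_mul_of_nonneg_left hy hR
  have h3 : (2 * B * (C₀ + 2 * M) + C₀ / 2 + 1 + 4 * B ^ 2) * 1 ≤
      (2 * B * (C₀ + 2 * M) + C₀ / 2 + 1 + 4 * B ^ 2) * y :=
    mul_le_mul_of_nonneg_left hy (by positivity)
  have h4 : (C₀ + 2 * M + 1) * y' ≤ (C₀ + 2 * M + 1) * y :=
    mul_le_mul_of_nonneg_left hyy (by positivity)
  have h5 : C₀ * l * y' ≤ C * l * y :=
    mul_le_mul (mul_le_mul_of_nonneg_right hCC hl) hyy hy' (by positivity)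
  have h6 : C₀ * l ^ 2 ≤ C * l ^ 2 := mul_le_mul_of_nonneg_right hCC (sq_nonneg l)
  linarith

/-! ### Tracking the Gibbs measures, and the resulting regret. -/

section Glauber

variable {V : Type*} [Fintype V] [DecidableEq V] [Nonempty V] {q : ℕ} {G : SimpleGraph V}
  [DecidableRel G.Adj] {β : ℝ} {μ₀ : V → Fin q → ℝ} {c : ℕ → LocalCosts V q} {t : ℕ}

theorem abs_discountedTotal_succ_sub_le (hβ : 0 ≤ β)
    (hc : ∀ s ∈ Finset.Icc 1 (t + 1), (c s).IsBounded G) (x : V → Fin q) :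
    |β * discountedTotal G c (t + 1) x - β * discountedTotal G c t x| ≤
      2 * (β * Fintype.card V * ((G.maxDegree : ℝ) + 1)) / ((t : ℝ) + 2) := by
  set D : ℝ := Fintype.card V * ((G.maxDegree : ℝ) + 1) with hD
  have hD0 : 0 ≤ D := by positivity
  have h1 : |∑ s ∈ Finset.Icc 1 t, (c s).total G x| ≤ ((t : ℝ) + 1) * D := by
    refine (Finset.abs_sum_le_sum_abs _ _).trans ((Finset.sum_le_sum fun s hs =>
      LocalCosts.abs_total_le (hc s ?_) x).trans ?_)
    · rw [Finset.mem_Icc] at hs ⊢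
      omega
    · simp only [Finset.sum_const, Nat.card_Icc, nsmul_eq_mul, add_tsub_cancel_right]
      exact mul_le_mul_of_nonneg_right (by linarith) hD0
  have h2 : |(c (t + 1)).total G x| ≤ D := LocalCosts.abs_total_le (hc _ (by simp)) x
  have h3 : |discountedTotal G c t x| ≤ D := by
    unfold discountedTotal
    rw [abs_mul, abs_of_nonneg (by positivity), one_div, inv_mul_le_iff₀ (by positivity)]
    exact h1
  have e : β * discountedTotal G c (t + 1) x - β * discountedTotal G c t x =
      β * ((c (t + 1)).total G x - discountedTotal G c t x) / ((t : ℝ) + 2) := by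
    unfold discountedTotal
    rw [Finset.sum_Icc_succ_top (by omega)]
    push_cast
    field_simp
    ring
  rw [e, abs_div, abs_of_pos (by positivity : (0 : ℝ) < (t : ℝ) + 2), abs_mul, abs_of_nonneg hβ]
  have h4 := (abs_sub _ _).trans (add_le_add h2 h3)
  have h5 := mul_le_mul_of_nonneg_left h4 hβ
  refine div_le_div_of_nonneg_right (h5.trans (le_of_eq ?_)) (by positivity)
  rw [hD]
  ring

theorem discountedTotal_osc_le (hβ : 0 ≤ β)
    (hc : ∀ s ∈ Finset.Icc 1 (t + 1), (c s).IsBounded G) (x y : V → Fin q) :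
    (β * discountedTotal G c t x - β * discountedTotal G c (t + 1) x) -
        (β * discountedTotal G c t y - β * discountedTotal G c (t + 1) y) ≤
      4 * (β * Fintype.card V * ((G.maxDegree : ℝ) + 1)) / ((t : ℝ) + 2) := by
  have h1 := abs_le.1 (abs_discountedTotal_succ_sub_le hβ hc x)
  have h2 := abs_le.1 (abs_discountedTotal_succ_sub_le hβ hc y)
  have e : 4 * (β * Fintype.card V * ((G.maxDegree : ℝ) + 1)) / ((t : ℝ) + 2) =
      2 * (2 * (β * Fintype.card V * ((G.maxDegree : ℝ) + 1)) / ((t : ℝ) + 2)) := by ring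
  rw [e]
  linarith

theorem tvDist_globalGibbs_succ_le [Nonempty (Fin q)] (hβ : 0 ≤ β) (hμ : ∀ v a, 0 < μ₀ v a)
    (hc : ∀ s ∈ Finset.Icc 1 (t + 1), (c s).IsBounded G) :
    tvDist (globalGibbs G β μ₀ c t) (globalGibbs G β μ₀ c (t + 1)) ≤
      β * Fintype.card V * ((G.maxDegree : ℝ) + 1) / ((t : ℝ) + 2) := by
  refine (tvDist_gibbsVec_le (productLaw_pos hμ) (discountedTotal_osc_le hβ hc)).trans
    (le_of_eq ?_)
  ring

/-- The law of the network tracks the slowly varying Gibbs measures in the Wasserstein distance. -/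
theorem sum_glauberLaw_sub_globalGibbs_mul_le [Nonempty (Fin q)] (hβ : 0 ≤ β)
    (hμ : ∀ v a, 0 < μ₀ v a) (hμ1 : ∀ v, μ₀ v ∈ stdSimplex ℝ (Fin q))
    {κ C : ℝ} (hκ : κ = (1 - G.maxDegree * β) / Fintype.card V) (hκ1 : κ ≤ 1)
    (hC : κ * C = β * (Fintype.card V : ℝ) ^ 2 * ((G.maxDegree : ℝ) + 1))
    (hc : ∀ s ∈ Finset.Icc 1 t, (c s).IsBounded G) {f : (V → Fin q) → ℝ} {L : ℝ} (hL : 0 ≤ L)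
    (hf : CoordLipschitz f L) :
    ∑ x, (glauberLaw G β μ₀ c (t + 1) x - globalGibbs G β μ₀ c t x) * f x ≤
      trackingBound κ C t * L := by
  induction t generalizing f L with
  | zero =>
    -- The chain starts at μ_0, which is the Gibbs measure at time 0 and is invariant under the
    -- first step, so the initial distance is 0.
    simp only [sub_mul, Finset.sum_sub_distrib]
    rw [sum_glauberLaw_succ_mul, ← sum_globalGibbs_mul_kernel hμ f, globalGibbs_zero hμ1]
    simp [glauberLaw, trackingBound]
  | succ t ih =>
    have hPf := hf.glauberKernel hβ hμ hc hL
    rw [← hκ] at hPf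
    set g := fun x => ∑ y, glauberKernel G β μ₀ c (t + 1) x y * f y with hg
    have hL' : 0 ≤ (1 - κ) * L := mul_nonneg (by linarith) hL
    have h1 := ih (fun s hs => hc s (by rw [Finset.mem_Icc] at hs ⊢; omega)) hL' hPf
    -- The drift of the Gibbs measures is known in total variation; the Hamming diameter `card V`
    -- converts it, which explains the extra factor `card V` in `κ * C`.
    have h2 := sum_sub_mul_le_tvDist (f := g)
      ((sum_globalGibbs (G := G) (β := β) (c := c) hμ t).trans
        (sum_globalGibbs (G := G) (β := β) (c := c) hμ (t + 1)).symm) hPf.sub_le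
    have h3 := mul_le_mul_of_nonneg_left (tvDist_globalGibbs_succ_le hβ hμ hc)
      (mul_nonneg (Nat.cast_nonneg (Fintype.card V)) hL')
    have e : ∑ x, (glauberLaw G β μ₀ c (t + 1 + 1) x - globalGibbs G β μ₀ c (t + 1) x) * f x =
        ∑ x, (glauberLaw G β μ₀ c (t + 1) x - globalGibbs G β μ₀ c t x) * g x +
        ∑ x, (globalGibbs G β μ₀ c t x - globalGibbs G β μ₀ c (t + 1) x) * g x := by
      simp only [sub_mul, Finset.sum_sub_distrib]
      rw [sum_glauberLaw_succ_mul, ← sum_globalGibbs_mul_kernel hμ f]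
      ring
    rw [e]
    unfold trackingBound
    rw [hC]
    refine (add_le_add h1 (h2.trans h3)).trans (le_of_eq ?_)
    ring

/-- An indicator is 1-Lipschitz for the Hamming distance, so the Wasserstein bound dominates total
variation. -/
theorem tvDist_glauberLaw_globalGibbs_le [Nonempty (Fin q)] (hβ : 0 ≤ β)
    (hμ : ∀ v a, 0 < μ₀ v a) (hμ1 : ∀ v, μ₀ v ∈ stdSimplex ℝ (Fin q))
    {κ C : ℝ} (hκ : κ = (1 - G.maxDegree * β) / Fintype.card V) (hκ1 : κ ≤ 1)
    (hC : κ * C = β * (Fintype.card V : ℝ) ^ 2 * ((G.maxDegree : ℝ) + 1))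
    (hc : ∀ s ∈ Finset.Icc 1 t, (c s).IsBounded G) :
    tvDist (glauberLaw G β μ₀ c (t + 1)) (globalGibbs G β μ₀ c t) ≤ trackingBound κ C t := by
  rw [tvDist_eq_sum_indicator]
  refine (sum_glauberLaw_sub_globalGibbs_mul_le hβ hμ hμ1 hκ hκ1 hC hc zero_le_one
    fun x v a => ?_).trans (mul_one _).le
  split_ifs <;> norm_num

theorem networkLoss_glauberLaw_sub_le [Nonempty (Fin q)] (hβ : 0 ≤ β)
    (hμ : ∀ v a, 0 < μ₀ v a) (hμ1 : ∀ v, μ₀ v ∈ stdSimplex ℝ (Fin q))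
    {κ C : ℝ} (hκ : κ = (1 - G.maxDegree * β) / Fintype.card V) (hκ1 : κ ≤ 1)
    (hC : κ * C = β * (Fintype.card V : ℝ) ^ 2 * ((G.maxDegree : ℝ) + 1))
    (hc : ∀ s ∈ Finset.Icc 1 (t + 1), (c s).IsBounded G)
    {θ : ℝ} (hθ : 0 < θ) (hθ1 : θ ≤ 1) (hw : ∀ x, θ ≤ productLaw μ₀ x) :
    networkLoss G β μ₀ (c (t + 1)) (glauberLaw G β μ₀ c (t + 1)) -
        networkLoss G β μ₀ (c (t + 1)) (globalGibbs G β μ₀ c t) ≤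
      trackingBound κ C t * (2 * (β * Fintype.card V * ((G.maxDegree : ℝ) + 1)) +
        (Real.log (1 / θ) + Fintype.card V * Real.log q) + Real.log ((t : ℝ) + 1)) +
        1 / ((t : ℝ) + 1) := by
  have hp1 := sum_glauberLaw (G := G) (β := β) (c := c) hμ hμ1 (t + 1)
  have hr1 := sum_globalGibbs (G := G) (β := β) (c := c) hμ t
  have htv := tvDist_glauberLaw_globalGibbs_le hβ hμ hμ1 hκ hκ1 hC
    (fun s hs => hc s (by rw [Finset.mem_Icc] at hs ⊢; omega)) (t := t)
  -- The choice `τ = t + 1` costs only `log (t + 1)` in the factor of the distance and leaves an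
  -- error whose sum is logarithmic.
  have h1 := relEntropy_sub_le (glauberLaw_nonneg hμ (t + 1))
    (fun x => (gibbsVec_pos (productLaw_pos hμ) _ x).le) hp1 hr1 hθ hw (productLaw_le_one hμ1)
    (by positivity : (0 : ℝ) < (t : ℝ) + 1)
  have h2 := sum_sub_mul_le_tvDist (f := (c (t + 1)).total G)
    (L := 2 * (Fintype.card V * ((G.maxDegree : ℝ) + 1))) (hp1.trans hr1.symm) fun x y => by
      have hx := abs_le.1 (LocalCosts.abs_total_le (hc (t + 1) (by simp)) x)
      have hy := abs_le.1 (LocalCosts.abs_total_le (hc (t + 1) (by simp)) y)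
      linarith
  have h3 := mul_le_mul_of_nonneg_left h2 hβ
  have hlog : Real.log (Fintype.card (V → Fin q)) = Fintype.card V * Real.log q := by
    rw [Fintype.card_fun, Fintype.card_fin, Nat.cast_pow, Real.log_pow]
  rw [hlog] at h1
  have hq : (0 : ℝ) ≤ Real.log q := Real.log_natCast_nonneg q
  have hlt : 0 ≤ Real.log ((t : ℝ) + 1) :=
    Real.log_nonneg (by linarith [(Nat.cast_nonneg t : (0 : ℝ) ≤ t)])
  have hlθ : 0 ≤ Real.log (1 / θ) := Real.log_nonneg (by rwa [one_le_div hθ])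
  have h4 := mul_le_mul_of_nonneg_right htv
    (by positivity : 0 ≤ 2 * (β * Fintype.card V * ((G.maxDegree : ℝ) + 1)) +
        (Real.log (1 / θ) + Fintype.card V * Real.log q) + Real.log ((t : ℝ) + 1))
  simp only [sub_mul, Finset.sum_sub_distrib] at h3
  unfold networkLoss
  refine le_trans ?_ (add_le_add_left h4 _)
  unfold globalGibbs at *
  linarith

theorem sum_Icc_one_eq_sum_range (g : ℕ → ℝ) (T : ℕ) :
    ∑ t ∈ Finset.Icc 1 T, g t = ∑ t ∈ Finset.range T, g (t + 1) := by
  induction T with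
  | zero => simp
  | succ T ih => rw [Finset.sum_Icc_succ_top (by omega), Finset.sum_range_succ, ih]

theorem sum_networkLoss_globalGibbs_le [Nonempty (Fin q)] (hβ : 0 ≤ β)
    (hμ : ∀ v a, 0 < μ₀ v a) (hμ1 : ∀ v, μ₀ v ∈ stdSimplex ℝ (Fin q)) {T : ℕ}
    (hc : ∀ s ∈ Finset.Icc 1 T, (c s).IsBounded G)
    {θ : ℝ} (hθ : 0 < θ) (hw : ∀ x, θ ≤ productLaw μ₀ x)
    {ν : (V → Fin q) → ℝ} (hν : ν ∈ stdSimplex ℝ (V → Fin q)) :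
    ∑ t ∈ Finset.range T, networkLoss G β μ₀ (c (t + 1)) (globalGibbs G β μ₀ c t) ≤
      ∑ t ∈ Finset.range T, networkLoss G β μ₀ (c (t + 1)) ν + Real.log (1 / θ) +
        4 * (β * Fintype.card V * ((G.maxDegree : ℝ) + 1)) ^ 2 * (1 + Real.log T) := by
  simp only [networkLoss_eq]
  have h1 := followTheLeader_le (productLaw_pos hμ) (sum_productLaw hμ1)
    (fun s x => β * (c s).total G x) (h := fun t x => β * discountedTotal G c t x)
    (fun t x => by rw [← Finset.mul_sum, discountedTotal]; ring) T hν.1 hν.2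
  have h2 := relEntropy_le_log_inv hν.1 hν.2 hθ hw
  have h3 : ∑ t ∈ Finset.range T, ((t : ℝ) + 2) *
      relEntropy (globalGibbs G β μ₀ c t) (globalGibbs G β μ₀ c (t + 1)) ≤
      ∑ t ∈ Finset.range T, 4 * (β * Fintype.card V * ((G.maxDegree : ℝ) + 1)) ^ 2 *
        (1 / ((t : ℝ) + 1)) := by
    refine Finset.sum_le_sum fun t ht => ?_
    have h4 := mul_le_mul_of_nonneg_left (relEntropy_gibbsVec_le (productLaw_pos hμ)
      (discountedTotal_osc_le (t := t) hβ fun s hs => hc s (by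
        rw [Finset.mem_Icc] at hs ⊢; rw [Finset.mem_range] at ht; omega)))
        (by positivity : (0 : ℝ) ≤ (t : ℝ) + 2)
    refine h4.trans ?_
    set B := β * Fintype.card V * ((G.maxDegree : ℝ) + 1)
    have e : ((t : ℝ) + 2) * ((4 * B / ((t : ℝ) + 2)) ^ 2 / 4) =
        4 * B ^ 2 * (1 / ((t : ℝ) + 2)) := by
      field_simp
    rw [e]
    refine mul_le_mul_of_nonneg_left ?_ (by positivity)
    exact one_div_le_one_div_of_le (by positivity) (by linarith)
  rw [← Finset.mul_sum] at h3
  have h5 := mul_le_mul_of_nonneg_left (sum_range_inv_le T)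
    (by positivity : 0 ≤ 4 * (β * Fintype.card V * ((G.maxDegree : ℝ) + 1)) ^ 2)
  unfold globalGibbs at *
  linarith

/-- The regret with all the lower order terms kept. -/
theorem networkRegret_glauberLaw_le [Nonempty (Fin q)] (hβ : 0 ≤ β)
    (hμ : ∀ v a, 0 < μ₀ v a) (hμ1 : ∀ v, μ₀ v ∈ stdSimplex ℝ (Fin q))
    {κ C M : ℝ} (hκ : κ = (1 - G.maxDegree * β) / Fintype.card V) (hκ1 : κ ≤ 1)
    (hC : κ * C = β * (Fintype.card V : ℝ) ^ 2 * ((G.maxDegree : ℝ) + 1)) (hC0 : 0 ≤ C)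
    (hM : 0 ≤ M) (hu : ∀ t : ℕ, trackingBound κ C t ≤
      C * (1 / ((t : ℝ) + 1)) + M * (1 / ((t : ℝ) + 1) ^ 2))
    {T : ℕ} (hT : 1 ≤ T) (hc : ∀ s ∈ Finset.Icc 1 T, (c s).IsBounded G)
    {θ : ℝ} (hθ : 0 < θ) (hθ1 : θ ≤ 1) (hw : ∀ x, θ ≤ productLaw μ₀ x) {B y : ℝ}
    (hB : B = β * Fintype.card V * ((G.maxDegree : ℝ) + 1))
    (hy : y = Real.log (1 / θ) + Fintype.card V * Real.log q) :
    networkRegret G β μ₀ c (glauberLaw G β μ₀ c) T ≤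
      (2 * B + y) * (C * (1 + Real.log T) + 2 * M) + C * (Real.log T ^ 2 / 2 + 1 / 2) +
        2 * M * Real.log T + (1 + Real.log T) + 4 * B ^ 2 * (1 + Real.log T) + y := by
  have hq : (0 : ℝ) ≤ Fintype.card V * Real.log q :=
    mul_nonneg (Nat.cast_nonneg _) (Real.log_natCast_nonneg q)
  have hlθ : 0 ≤ Real.log (1 / θ) := Real.log_nonneg (by rwa [one_le_div hθ])
  have hB0 : 0 ≤ B := by rw [hB]; positivity
  have hE : 0 ≤ 2 * B + y := by linarith
  unfold networkRegret
  have : Nonempty (stdSimplex ℝ (V → Fin q)) :=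
    ⟨⟨productLaw μ₀, fun x => (productLaw_pos hμ x).le, sum_productLaw hμ1⟩⟩
  rw [sub_le_comm]
  refine le_ciInf fun ν => ?_
  rw [sub_le_comm, sum_Icc_one_eq_sum_range, sum_Icc_one_eq_sum_range]
  have h1 := sum_networkLoss_globalGibbs_le hβ hμ hμ1 hc hθ hw ν.2
  have h2 : ∑ t ∈ Finset.range T,
      (networkLoss G β μ₀ (c (t + 1)) (glauberLaw G β μ₀ c (t + 1)) -
        networkLoss G β μ₀ (c (t + 1)) (globalGibbs G β μ₀ c t)) ≤
      ∑ t ∈ Finset.range T, (trackingBound κ C t * (2 * B + y + Real.log ((t : ℝ) + 1)) +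
        1 / ((t : ℝ) + 1)) := by
    rw [hB, hy]
    exact Finset.sum_le_sum fun t ht => networkLoss_glauberLaw_sub_le hβ hμ hμ1 hκ hκ1 hC
      (fun s hs => hc s (by rw [Finset.mem_Icc] at hs ⊢; rw [Finset.mem_range] at ht; omega))
      hθ hθ1 hw
  rw [Finset.sum_sub_distrib, Finset.sum_add_distrib] at h2
  have h3 := sum_mul_add_log_le hC0 hM hE hu hT
  have h4 := sum_range_inv_le T
  rw [← hB] at h1
  linarith

end Glauber

/-! ### The one-action case and the minimal probabilities. -/

theorem networkRegret_glauberLaw_nonpos_of_subsingleton {V : Type*} [Fintype V] [DecidableEq V]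
    [Nonempty V] {q : ℕ} [Nonempty (Fin q)] [Subsingleton (Fin q)] {G : SimpleGraph V}
    [DecidableRel G.Adj] {β : ℝ} {μ₀ : V → Fin q → ℝ} {c : ℕ → LocalCosts V q}
    (hμ : ∀ v a, 0 < μ₀ v a) (hμ1 : ∀ v, μ₀ v ∈ stdSimplex ℝ (Fin q)) (T : ℕ) :
    networkRegret G β μ₀ c (glauberLaw G β μ₀ c) T ≤ 0 := by
  have hone : ∀ ν : (V → Fin q) → ℝ, ∑ x, ν x = 1 → ν = fun _ => 1 := by
    intro ν hν
    funext x
    rwa [Fintype.sum_eq_single x fun y hy => absurd (Subsingleton.elim y x) hy] at hν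
  unfold networkRegret
  have : Nonempty (stdSimplex ℝ (V → Fin q)) :=
    ⟨⟨productLaw μ₀, fun x => (productLaw_pos hμ x).le, sum_productLaw hμ1⟩⟩
  rw [sub_nonpos]
  refine le_ciInf fun ν => Finset.sum_le_sum fun t _ => ?_
  rw [hone _ (sum_glauberLaw hμ hμ1 t), hone _ ν.2.2]

section MinProb

variable {V : Type*} {q : ℕ} {μ₀ : V → Fin q → ℝ}

theorem minLocalProb_le [Finite V] (μ₀ : V → Fin q → ℝ) (v : V) (a : Fin q) :
    minLocalProb μ₀ ≤ μ₀ v a :=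
  (ciInf_le (Set.finite_range _).bddBelow v).trans (ciInf_le (Set.finite_range _).bddBelow a)

theorem minLocalProb_pos [Finite V] [Nonempty V] [Nonempty (Fin q)] (hμ : ∀ v a, 0 < μ₀ v a) :
    0 < minLocalProb μ₀ := by
  obtain ⟨v, hv⟩ := exists_eq_ciInf_of_finite (f := fun v => ⨅ a, μ₀ v a)
  obtain ⟨a, ha⟩ := exists_eq_ciInf_of_finite (f := fun a => μ₀ v a)
  unfold minLocalProb
  rw [← hv, ← ha]
  exact hμ v a

theorem log_one_div_minProfileProb_nonneg [Fintype V] [Nonempty (Fin q)]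
    (hμ : ∀ v a, 0 < μ₀ v a) (hμ1 : ∀ v, μ₀ v ∈ stdSimplex ℝ (Fin q)) :
    0 ≤ Real.log (1 / minProfileProb μ₀) := by
  classical
  obtain ⟨x, hx⟩ := exists_eq_ciInf_of_finite (f := fun x : V → Fin q => productLaw μ₀ x)
  unfold minProfileProb
  rw [← hx]
  refine Real.log_nonneg ?_
  rw [one_le_div (productLaw_pos hμ x)]
  exact productLaw_le_one hμ1 x

theorem minLocalProb_pow_le_productLaw [Fintype V] [Nonempty V] [Nonempty (Fin q)]
    (hμ : ∀ v a, 0 < μ₀ v a) (x : V → Fin q) :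
    minLocalProb μ₀ ^ Fintype.card V ≤ productLaw μ₀ x := by
  unfold productLaw
  rw [← Finset.card_univ, ← Finset.prod_const]
  exact Finset.prod_le_prod (fun _ _ => (minLocalProb_pos hμ).le) fun v _ =>
    minLocalProb_le μ₀ v (x v)

end MinProb

/-! ### The explicit bound. -/

/-- The other summands of the bound are nonnegative and are discarded; the two kept here already
dominate the regret. -/
theorem le_regretBound {β : ℝ} {n Δ q : ℕ} {θd θ T₁ : ℝ} {T : ℕ} (hβ : 0 < β)
    (hΔβ : (Δ : ℝ) * β < 1) (hT : 1 ≤ T) (hΛ : 0 ≤ Real.log ((q : ℝ) ^ 2 / θd))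
    (hθ : 0 ≤ Real.log (1 / θ)) :
    (n / (1 - Δ * β) * max (n : ℝ) (β * (n : ℝ) ^ 2 * ((Δ : ℝ) + 1))) *
        (n * Real.log ((q : ℝ) ^ 2 / θd) + Real.log T) * Real.log T +
      T₁ * (n * Real.log ((q : ℝ) ^ 2 / θd)) ≤ regretBound β n Δ q θd θ T₁ T := by
  have hT' : (1 : ℝ) ≤ T := by exact_mod_cast hT
  have hl : 0 ≤ Real.log T := Real.log_nonneg hT'
  have hl1 : Real.log T ≤ Real.log ((T : ℝ) + 1) := Real.log_le_log (by linarith) (by linarith)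
  have hr : 0 ≤ (n : ℝ) / (1 - Δ * β) := div_nonneg (Nat.cast_nonneg n) (by linarith)
  unfold regretBound
  simp only
  set K := max (n : ℝ) (β * (n : ℝ) ^ 2 * ((Δ : ℝ) + 1))
  have hK : 0 ≤ K := (Nat.cast_nonneg n).trans (le_max_left _ _)
  set Λ := Real.log ((q : ℝ) ^ 2 / θd)
  set l' := Real.log ((T : ℝ) + 1)
  have hl' : 0 ≤ l' := hl.trans hl1
  set r := (n : ℝ) / (1 - Δ * β)
  have h1 : r * K * (n * Λ + Real.log T) * Real.log T ≤ r * K * (n * Λ + Real.log T) * l' :=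
    mul_le_mul_of_nonneg_left hl1 (by positivity)
  have h2 : 0 ≤ r * (2 * β ^ 2 * (n : ℝ) ^ 3 * ((Δ : ℝ) + 1) ^ 2) * l' := by positivity
  have h3 : 0 ≤ 2 * (β * n * ((Δ : ℝ) + 1)) ^ 2 * l' := by positivity
  have h4 : 0 ≤ 2 * β * (n : ℝ) ^ 3 * ((Δ : ℝ) + 1) / (1 - Δ * β) :=
    div_nonneg (by positivity) (by linarith)
  linarith

theorem theorem1 (β : ℝ) (n Δ : ℕ) (hβ : 0 < β) (hΔβ : (Δ : ℝ) * β < 1) :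
    ∃ T₁ : ℝ, 0 < T₁ ∧
      ∀ (V : Type*) [Fintype V] [DecidableEq V] [Nonempty V]
        (G : SimpleGraph V) [DecidableRel G.Adj] (q : ℕ)
        (μ₀ : V → Fin q → ℝ) (Φ : Set (Fin q → ℝ)) (Ψ : Set (Fin q → Fin q → ℝ)),
        Fintype.card V = n →
        G.maxDegree = Δ →
        (∀ v, μ₀ v ∈ stdSimplex ℝ (Fin q)) →
        (∀ v a, 0 < μ₀ v a) →
        (∀ φ ∈ Φ, ∀ a, φ a ∈ Set.Icc (-1 : ℝ) 1) →
        (∀ ψ ∈ Ψ, ∀ a b, ψ a b ∈ Set.Icc (-1 : ℝ) 1) →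
        ∀ T : ℕ, 1 ≤ T →
          glauberWorstCaseRegret G β μ₀ Φ Ψ T ≤
            (regretBound β n Δ q (minLocalProb μ₀) (minProfileProb μ₀) T₁ T : EReal) := by
  rcases Nat.eq_zero_or_pos n with hn | hn
  · refine ⟨1, one_pos, ?_⟩
    intro V _ _ _ G _ q μ₀ Φ Ψ hcard
    exact absurd (hcard.trans hn) Fintype.card_ne_zero
  have hn1 : (1 : ℝ) ≤ n := by exact_mod_cast hn
  have hn0 : (0 : ℝ) < n := by linarith
  have hgap : 0 < 1 - (Δ : ℝ) * β := by linarith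
  obtain ⟨κ, hκ⟩ : ∃ κ : ℝ, κ = (1 - Δ * β) / n := ⟨_, rfl⟩
  have hκ0 : 0 < κ := by rw [hκ]; positivity
  have hκ1 : κ ≤ 1 := by
    rw [hκ, div_le_one hn0]
    have : 0 ≤ (Δ : ℝ) * β := by positivity
    linarith
  obtain ⟨C₀, hC₀⟩ : ∃ C₀ : ℝ, C₀ = n / (1 - Δ * β) * (β * (n : ℝ) ^ 2 * ((Δ : ℝ) + 1)) :=
    ⟨_, rfl⟩
  obtain ⟨C, hC⟩ : ∃ C : ℝ,
    C = n / (1 - Δ * β) * max (n : ℝ) (β * (n : ℝ) ^ 2 * ((Δ : ℝ) + 1)) := ⟨_, rfl⟩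
  obtain ⟨B, hB⟩ : ∃ B : ℝ, B = β * n * ((Δ : ℝ) + 1) := ⟨_, rfl⟩
  have hr : 0 < (n : ℝ) / (1 - Δ * β) := by positivity
  have hC₀0 : 0 ≤ C₀ := by rw [hC₀]; positivity
  have hCC : C₀ ≤ C := by
    rw [hC₀, hC]
    exact mul_le_mul_of_nonneg_left (le_max_right _ _) hr.le
  have hC0 : 0 < C := by
    rw [hC]
    exact mul_pos hr (hn0.trans_le (le_max_left _ _))
  have hB0 : 0 ≤ B := by rw [hB]; positivity
  have hκC : κ * C₀ = β * (n : ℝ) ^ 2 * ((Δ : ℝ) + 1) := by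
    rw [hκ, hC₀]
    field_simp
  obtain ⟨M, hM, hu⟩ := exists_trackingBound_le hκ0 hκ1 hC₀0
  -- The coefficient of `y` produced by `absorb_lower_order`; it involves only `β`, `Δ` and `n`,
  -- since `M` comes from `κ` and `C₀`.
  refine ⟨C₀ + 2 * M + 1 + (2 * B * (C₀ + 2 * M) + C₀ / 2 + 1 + 4 * B ^ 2) +
    (2 * B * C₀ + 2 * M + 1 + 4 * B ^ 2) ^ 2 / (2 * C), by positivity, ?_⟩
  intro V _ _ _ G _ q μ₀ Φ Ψ hcard hdeg hμ1 hμ hΦ hΨ T hT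
  refine iSup₂_le fun c hmem => EReal.coe_le_coe_iff.2 ?_
  have hc : ∀ s ∈ Finset.Icc 1 T, (c s).IsBounded G := fun s hs => (hmem s hs).isBounded hΦ hΨ
  have hq : Nonempty (Fin q) := by
    by_contra hq
    rw [not_nonempty_iff] at hq
    obtain ⟨v⟩ := ‹Nonempty V›
    simpa using (hμ1 v).2
  obtain ⟨a⟩ := id hq
  obtain ⟨v⟩ := id ‹Nonempty V›
  have hθd := minLocalProb_pos hμ
  have hθd1 : minLocalProb μ₀ ≤ 1 := (minLocalProb_le μ₀ v a).trans
    ((hμ1 v).2 ▸ Finset.single_le_sum (fun b _ => (hμ1 v).1 b) (Finset.mem_univ a))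
  have hlθ : 0 ≤ Real.log (1 / minLocalProb μ₀) := Real.log_nonneg (by rwa [one_le_div hθd])
  have hq0 : 0 < q := a.pos
  have hq0' : (0 : ℝ) < q := by exact_mod_cast hq0
  have hlq : 0 ≤ Real.log q := Real.log_natCast_nonneg q
  have hΛ : Real.log ((q : ℝ) ^ 2 / minLocalProb μ₀) =
      2 * Real.log q + Real.log (1 / minLocalProb μ₀) := by
    rw [Real.log_div (by positivity) hθd.ne', Real.log_pow, one_div, Real.log_inv]
    push_cast
    ring
  refine le_trans ?_ (le_regretBound hβ hΔβ hT (by rw [hΛ]; positivity)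
    (log_one_div_minProfileProb_nonneg hμ hμ1))
  rw [← hC, hΛ]
  have hlT : 0 ≤ Real.log T := Real.log_natCast_nonneg T
  -- For `q = 1` the logarithm multiplying `T₁` vanishes and can absorb nothing, but then there is
  -- only one law. For `q ≥ 2` it is at least `2 * log 2 > 1`.
  rcases (Nat.succ_le_of_lt hq0).eq_or_lt with hq1 | hq2
  · have : Subsingleton (Fin q) := by rw [← hq1]; infer_instance
    exact (networkRegret_glauberLaw_nonpos_of_subsingleton hμ hμ1 T).trans (by positivity)
  · have hlogq : 2 * Real.log 2 ≤ 2 * Real.log q :=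
      mul_le_mul_of_nonneg_left (Real.log_le_log two_pos (by exact_mod_cast hq2)) two_pos.le
    have hone : 1 ≤ 2 * Real.log q + Real.log (1 / minLocalProb μ₀) := by
      linarith [Real.log_two_gt_d9]
    subst hdeg
    -- The lower bound on the product law is taken to be the `n`-th power of the minimal local
    -- probability, so that the entropy constant is `n * (log (1 / θd) + log q)`, at most `n * log
    -- (q ^ 2 / θd)`.
    have hreg := networkRegret_glauberLaw_le (c := c) hβ.le hμ hμ1 (hcard ▸ hκ) hκ1
      (hcard ▸ hκC) hC₀0 hM hu hT hc (pow_pos hθd (Fintype.card V))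
      (pow_le_one₀ hθd.le hθd1) (minLocalProb_pow_le_productLaw hμ) (hcard ▸ hB) rfl
    refine hreg.trans (absorb_lower_order hC₀0 hCC hC0 hM hB0 hlT ?_ ?_ ?_)
    all_goals
      try rw [← one_div_pow, Real.log_pow, hcard, ← mul_add]
    · positivity
    · exact mul_le_mul_of_nonneg_left (by linarith) hn0.le
    · nlinarith
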